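/- Let $n\ge 1$, let $M$ be a smooth manifold and let $\omega\in\Omega^{n+1}(M)$ be a closed form. The Lie $n$-algebra of observables $L=L(M,\omega)=\bigoplus_{i=-n+1}^{0}L_i$ is the graded real vector space with $$L_0=\{(v,\alpha)\in\mathfrak X(M)\times\Omega^{n-1}(M)\mid d\alpha=-\iota_v\omega\},\qquad L_{i}=\Omega^{n-1+i}(M)\quad(-n+1\le i<0),$$ with the graded skew-symmetric brackets $l_k$ of degree $2-k$ given as follows: $l_1=0$ on $L_0$, $l_1(\alpha)=(0,d\alpha)$ for $\alpha\in L_{-1}$, $l_1(\alpha)=d\alpha$ for $\alpha\in L_i$, $i<-1$; $l_2((v,\alpha),(w,\beta))=([v,w],\iota_w\iota_v\omega)$ on $L_0$; $l_k((v_1,\alpha_1),\dots,(v_k,\alpha_k))=-(-1)^{k(k+1)/2}\,\iota_{v_k}\cdots\iota_{v_1}\omega$ on $L_0$ for $k\ge 3$; and $l_k$, $k\ge2$, vanishes whenever one of its homogeneous arguments has nonzero degree. An $L_\infty$-morphism $F:(V,l_i)\to(V',l_i')$ is a family of graded skew-symmetric multilinear maps $f_k:V^k\to V'$, $k\ge 1$,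 of degree $1-k$, such that for all $m\ge1$ and all homogeneous $x_1,\dots,x_m\in V$ $$\sum_{i+j=m+1}\ \sum_{\sigma\in ush(i,m-i)}(-1)^{i(j+1)}\,\mathrm{sgn}(\sigma)\,\epsilon(\sigma)\,f_j\big(l_i(x_{\sigma(1)},\dots,x_{\sigma(i)}),x_{\sigma(i+1)},\dots,x_{\sigma(m)}\big)$$ $$=\sum_{p=1}^m\ \sum_{\substack{k_1+\dots+k_p=m\\ 1\le k_1\le\dots\le k_p}}\ \sum_{\sigma}(-1)^{\beta}\,\mathrm{sgn}(\sigma)\,\epsilon(\sigma)\,l'_p\big(f_{k_1}(x_{\sigma(1)},\dots,x_{\sigma(k_1)}),\dots,f_{k_p}(x_{\sigma(m-k_p+1)},\dots,x_{\sigma(m)})\big).$$ Here $i,j\ge1$, $ush$ denotes unshuffles, $\epsilon(\sigma)$ is the Koszul sign of $\sigma$ acting on $x_1,\dots,x_m$, the last sum runs over the $(k_1,\dots,k_p)$-unshuffles $\sigma$ with $\sigma(k_1+\dots+k_{j-1}+1)<\sigma(k_1+\dots+k_j+1)$ whenever $k_j=k_{j+1}$, and $$\beta=\tfrac{p(p-1)}2+\sum_{i=1}^pk_i(p-i)+\sum_{j=2}^p(k_j-1)\sum_{i=1}^{k_1+\dots+k_{j-1}}|x_{\sigma(i)}|.$$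 Let $\mathfrak g$ be a finite-dimensional real Lie algebra, regarded as a graded space concentrated in degree $0$ with $l_2=[\cdot,\cdot]$ and all other brackets zero. Let $\zeta:\mathfrak g\to\mathfrak X(M)$ be a homomorphism of Lie algebras (an infinitesimal action) with $\mathcal L_{\zeta(X)}\omega=0$ for all $X\in\mathfrak g$. A homotopy co-moment map for $\zeta$ is an $L_\infty$-morphism $F=\{f_k\}:\mathfrak g\to L(M,\omega)$ lifting $\zeta$, that is, the vector field component of $f_1(X)\in L_0$ is $\zeta(X)$ for all $X\in\mathfrak g$. The action is called strongly Hamiltonian if a homotopy co-moment map for it exists. **Lemma.** Suppose that $\omega$ has a $\mathfrak g$-invariant potential, that is, a form $\eta\in\Omega^n(M)$ with $d\eta=\omega$ and $\mathcal L_{\zeta(X)}\eta=0$ for all $X\in\mathfrak g$. Then the action $\zeta$ is strongly Hamiltonian. More precisely, the maps $$f_1(X)=(\zeta(X),\iota_{\zeta(X)}\eta),\qquad f_k(X_1,\dots,X_k)=(-1)^k(-1)^{\frac{k(k+1)}2}\,\iota_{\zeta(X_k)}\cdots\iota_{\zeta(X_1)}\eta\quad(k\ge2)$$ (so that $f_k=0$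 for $k>n$) form a homotopy co-moment map for $\zeta$. -/

import Mathlib

open scoped Manifold Topology

noncomputable section

namespace Multisymplectic

section Forms

variable (E : Type*) [NormedAddCommGroup E] [NormedSpace ℝ E]
  (M : Type*) [TopologicalSpace M] [ChartedSpace E M]

/-- The order of smoothness `C^∞`. -/
abbrev smooth : WithTop ℕ∞ := ((⊤ : ℕ∞) : WithTop ℕ∞)

/-- Not necessarily smooth fields of alternating `k`-forms on the tangent spaces of `M`. -/
abbrev FormField (k : ℕ) : Type _ := ∀ p : M, TangentSpace 𝓘(ℝ, E) p [⋀^Fin k]→L[ℝ] ℝ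

variable {E M}

/-- The derivative at `x` of the inverse of the chart around `p₀`. -/
def dChartSymm (p₀ : M) (x : E) :
    E →L[ℝ] TangentSpace 𝓘(ℝ, E) ((extChartAt 𝓘(ℝ, E) p₀).symm x) :=
  mfderivWithin 𝓘(ℝ, E) 𝓘(ℝ, E) (extChartAt 𝓘(ℝ, E) p₀).symm (Set.range 𝓘(ℝ, E)) x

/-- The derivative at `p` of the chart around `p₀`. -/
def dChart (p₀ p : M) : TangentSpace 𝓘(ℝ, E) p →L[ℝ] E :=
  mfderiv 𝓘(ℝ, E) 𝓘(ℝ, E) (extChartAt 𝓘(ℝ, E) p₀) p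

/-- The coordinate expression of a field of forms in the chart around `p₀`: its pullback under
the inverse of the chart. -/
def chartRep {k : ℕ} (p₀ : M) (ω : FormField E M k) (x : E) : E [⋀^Fin k]→L[ℝ] ℝ :=
  (ω ((extChartAt 𝓘(ℝ, E) p₀).symm x)).compContinuousLinearMap (dChartSymm p₀ x)

/-- The coordinate expression of a vector field in the chart around `p₀`. -/
def vecRep (p₀ : M) (v : ∀ p : M, TangentSpace 𝓘(ℝ, E) p) (x : E) : E :=
  VectorField.mpullbackWithin 𝓘(ℝ, E) 𝓘(ℝ, E) (extChartAt 𝓘(ℝ, E) p₀).symm v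
    (Set.range 𝓘(ℝ, E)) x

variable (E M) in
/-- The smooth differential `k`-forms, that is, the fields of alternating `k`-forms whose coordinate
expressions are smooth. -/
def smoothForms (k : ℕ) : Submodule ℝ (FormField E M k) where
  carrier := {ω | ∀ p₀ : M, ContDiffOn ℝ smooth (chartRep p₀ ω) (extChartAt 𝓘(ℝ, E) p₀).target}
  add_mem' ha hb p₀ := (ha p₀).add (hb p₀)
  zero_mem' _ := contDiffOn_const (c := 0)
  smul_mem' c _ ha p₀ := (contDiffOn_const (c := c)).smul (ha p₀)

variable (E M) in
/-- `Ω^k(M)`: the space of smooth differential `k`-forms. -/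
def DiffForm (k : ℕ) : Type _ := smoothForms E M k

instance (k : ℕ) : AddCommGroup (DiffForm E M k) := inferInstanceAs (AddCommGroup (smoothForms E M k))

instance (k : ℕ) : Module ℝ (DiffForm E M k) := inferInstanceAs (Module ℝ (smoothForms E M k))

/-- The contraction `ι_v ω = ω(v, ·, …, ·)`, pointwise. -/
def contractField {k : ℕ} (v : ∀ p : M, TangentSpace 𝓘(ℝ, E) p) (ω : FormField E M (k + 1)) :
    FormField E M k :=
  fun p => ContinuousAlternatingMap.curryLeft (E := E) (ω p) (v p)

/-- The exterior derivative, computed at each point in the chart around this point. -/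
def extDField {k : ℕ} (ω : FormField E M k) : FormField E M (k + 1) :=
  fun p => (extDeriv (chartRep p ω) (extChartAt 𝓘(ℝ, E) p p)).compContinuousLinearMap (dChart p p)

/-- The Lie derivative of the form `η` along the vector field `V`, at the point `x` of a vector
space: `(L_V η)(u₁, …, u_k) = (D_V η)(u₁, …, u_k) + ∑ i, η(u₁, …, DV(u_i), …, u_k)`. -/
def lieDerivVec {k : ℕ} (V : E → E) (η : E → E [⋀^Fin k]→L[ℝ] ℝ) (x : E) (u : Fin k → E) : ℝ :=
  fderiv ℝ η x (V x) u + ∑ i, η x (Function.update u i (fderiv ℝ V x (u i)))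

/-- The Lie derivative `L_v ω` at `p`, computed in the chart around `p` and evaluated on tangent
vectors `u₁, …, u_k` at `p`. -/
def lieDeriv {k : ℕ} (v : ∀ p : M, TangentSpace 𝓘(ℝ, E) p) (ω : FormField E M k) (p : M)
    (u : Fin k → TangentSpace 𝓘(ℝ, E) p) : ℝ :=
  lieDerivVec (vecRep p v) (chartRep p ω) (extChartAt 𝓘(ℝ, E) p p) (fun i => dChart p p (u i))

lemma hasFDerivAt_curryLeft {k : ℕ} {V : E → E} {η : E → E [⋀^Fin (k + 1)]→L[ℝ] ℝ} {x : E}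
    (hV : DifferentiableAt ℝ V x) (hη : DifferentiableAt ℝ η x) :
    HasFDerivAt (fun y => (η y).curryLeft (V y))
      (((ContinuousAlternatingMap.curryLeftLI (𝕜 := ℝ) (E := E) (F := ℝ)
        (n := k)).toContinuousLinearMap.comp (fderiv ℝ η x)).flip (V x) +
        ((η x).curryLeft).comp (fderiv ℝ V x)) x := by
  have h1 : HasFDerivAt (fun y => (η y).curryLeft)
      ((ContinuousAlternatingMap.curryLeftLI (𝕜 := ℝ) (E := E) (F := ℝ)
      (n := k)).toContinuousLinearMap.comp (fderiv ℝ η x)) x :=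
    HasFDerivAt.comp (g := fun a => ContinuousAlternatingMap.curryLeft a) x
      ((ContinuousAlternatingMap.curryLeftLI (𝕜 := ℝ) (E := E) (F := ℝ)
      (n := k)).toContinuousLinearMap.hasFDerivAt (x := η x)) hη.hasFDerivAt
  have := h1.clm_apply hV.hasFDerivAt
  rw [add_comm]
  exact this

lemma lieDerivVec_eq {k : ℕ} {V : E → E} {η : E → E [⋀^Fin (k + 1)]→L[ℝ] ℝ} {x : E}
    (hV : DifferentiableAt ℝ V x) (hη : DifferentiableAt ℝ η x) (u : Fin (k + 1) → E) :
    lieDerivVec V η x u =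
      extDeriv (fun y => (η y).curryLeft (V y)) x u + extDeriv η x (Matrix.vecCons (V x) u) := by
  have hc := hasFDerivAt_curryLeft hV hη
  rw [extDeriv, extDeriv, hc.fderiv, ContinuousAlternatingMap.alternatizeUncurryFin_apply,
    ContinuousAlternatingMap.alternatizeUncurryFin_apply, Fin.sum_univ_succ (n := k + 1)]
  simp only [Fin.val_zero, pow_zero, one_smul, Matrix.cons_val_zero, Matrix.cons_val_succ,
    Fin.val_succ, lieDerivVec]
  have h0 : (Fin.removeNth 0 (Matrix.vecCons (V x) u)) = u := by
    ext i; simp [Fin.removeNth]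
  rw [h0, ← add_assoc, add_comm (∑ _, _), add_assoc, ← Finset.sum_add_distrib]
  congr 1
  refine Finset.sum_congr rfl fun i _ => ?_
  have h1 : (Fin.removeNth i.succ (Matrix.vecCons (V x) u)) =
      Matrix.vecCons (V x) (Fin.removeNth i u) := by
    ext j
    refine Fin.cases ?_ (fun j => ?_) j <;> simp [Fin.removeNth]
  have h2 : Function.update u i (fderiv ℝ V x (u i)) =
      Fin.insertNth i (fderiv ℝ V x (u i)) (Fin.removeNth i u) := by simp
  rw [h1, h2, ContinuousAlternatingMap.map_insertNth]
  simp [pow_succ]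


/-- For vector fields `U`, `V` on a vector space and a form `η` with `dη = 0`, `d(ι_V η) = 0` and
`d(ι_U η) = 0` one has `d(ι_U ι_V η) = - ι_{[V, U]} η`. -/
lemma extDeriv_contract_contract {k : ℕ} {U V : E → E} {η : E → E [⋀^Fin (k + 2)]→L[ℝ] ℝ} {x : E}
    (hU : DifferentiableAt ℝ U x) (hV : DifferentiableAt ℝ V x) (hη : DifferentiableAt ℝ η x)
    (h0 : extDeriv η x = 0) (h1 : extDeriv (fun y => (η y).curryLeft (V y)) x = 0)
    (h2 : extDeriv (fun y => (η y).curryLeft (U y)) x = 0) :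
    extDeriv (fun y => ((η y).curryLeft (V y)).curryLeft (U y)) x =
      - (η x).curryLeft (VectorField.lieBracket ℝ V U x) := by
  have hc : HasFDerivAt (fun y => (η y).curryLeft (V y))
      (((ContinuousAlternatingMap.curryLeftLI (𝕜 := ℝ) (E := E) (F := ℝ)
        (n := k + 1)).toContinuousLinearMap.comp (fderiv ℝ η x)).flip (V x) +
        ((η x).curryLeft).comp (fderiv ℝ V x)) x := hasFDerivAt_curryLeft hV hη
  ext u
  have e1 := lieDerivVec_eq hU hη (Matrix.vecCons (V x) u)
  have e2 := lieDerivVec_eq hU hc.differentiableAt u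
  have z1 : ∀ (j : ℕ) (w : Fin j → E), (0 : E [⋀^Fin j]→L[ℝ] ℝ) w = 0 := fun _ _ => rfl
  rw [h2, h0, z1, z1, add_zero] at e1
  rw [h1, z1, add_zero] at e2
  rw [← e2]
  simp only [lieDerivVec, hc.fderiv] at e1 ⊢
  rw [Fin.sum_univ_succ] at e1
  have h3 : ∀ a : E, Function.update (Matrix.vecCons (V x) u) 0 a = Matrix.vecCons a u := by
    intro a; ext j; refine Fin.cases ?_ (fun j => ?_) j <;> simp
  have h4 : ∀ (a : E) (i : Fin (k + 1)), Function.update (Matrix.vecCons (V x) u) i.succ a =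
      Matrix.vecCons (V x) (Function.update u i a) := by
    intro a i; ext j
    refine Fin.cases ?_ (fun j => ?_) j
    · simp [Function.update, (Fin.succ_ne_zero i).symm]
    · simp [Function.update]
  simp only [h3, h4, Matrix.cons_val_zero, Matrix.cons_val_succ] at e1
  have h5 : η x (Matrix.vecCons (VectorField.lieBracket ℝ V U x) u) =
      η x (Matrix.vecCons (fderiv ℝ U x (V x)) u) - η x (Matrix.vecCons (fderiv ℝ V x (U x)) u) := by
    have := (η x).curryLeft.map_sub (fderiv ℝ U x (V x)) (fderiv ℝ V x (U x))
    exact congrArg (fun a => a u) this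
  simp only [ContinuousAlternatingMap.neg_apply, ContinuousAlternatingMap.curryLeft_apply_apply, h5]
  simp only [_root_.add_apply, ContinuousAlternatingMap.add_apply,
    ContinuousLinearMap.flip_apply, ContinuousLinearMap.comp_apply,
    ContinuousAlternatingMap.curryLeft_apply_apply]
  have h6 : ((ContinuousAlternatingMap.curryLeftLI (𝕜 := ℝ) (E := E) (F := ℝ)
        (n := k + 1)).toContinuousLinearMap (fderiv ℝ η x (U x))) (V x) u =
      fderiv ℝ η x (U x) (Matrix.vecCons (V x) u) := rfl
  rw [h6]
  linarith

section Charts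

variable [IsManifold 𝓘(ℝ, E) smooth M]

instance : IsManifold 𝓘(ℝ, E) 1 M := IsManifold.of_le (n := smooth) (by simp)

lemma dChartSymm_comp_dChart {p₀ p : M} (hp : p ∈ (extChartAt 𝓘(ℝ, E) p₀).source)
    (u : TangentSpace 𝓘(ℝ, E) p) :
    (dChartSymm p₀ (extChartAt 𝓘(ℝ, E) p₀ p) (dChart p₀ p u) : E) = u :=
  DFunLike.congr_fun (mfderivWithin_extChartAt_symm_comp_mfderiv_extChartAt' hp) u

lemma dChart_comp_dChartSymm {p₀ : M} {x : E} (hx : x ∈ (extChartAt 𝓘(ℝ, E) p₀).target) (u : E) :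
    dChart p₀ ((extChartAt 𝓘(ℝ, E) p₀).symm x) (dChartSymm p₀ x u) = u :=
  DFunLike.congr_fun (mfderiv_extChartAt_comp_mfderivWithin_extChartAt_symm hx) u

lemma dChartSymm_vecRep {p₀ : M} {x : E} (hx : x ∈ (extChartAt 𝓘(ℝ, E) p₀).target)
    (v : ∀ p : M, TangentSpace 𝓘(ℝ, E) p) :
    dChartSymm p₀ x (vecRep p₀ v x) = v ((extChartAt 𝓘(ℝ, E) p₀).symm x) := by
  have h := isInvertible_mfderivWithin_extChartAt_symm (I := 𝓘(ℝ, E)) hx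
  exact h.self_apply_inverse _

/-- A field of forms is recovered from its coordinate expression. -/
lemma eq_chartRep {k : ℕ} (p : M) (ω : FormField E M k) (u : Fin k → TangentSpace 𝓘(ℝ, E) p) :
    ω p u = chartRep p ω (extChartAt 𝓘(ℝ, E) p p) (fun i => dChart p p (u i)) := by
  have h : ∀ q (hq : q = p), ∀ w : Fin k → E, (∀ i, w i = u i) → ω p u = ω q w := by
    rintro q rfl w hw
    congr 1
    funext i
    exact (hw i).symm
  exact h _ (extChartAt_to_inv p) _ fun i => dChartSymm_comp_dChart (mem_extChartAt_source p) (u i)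

lemma chartRep_contractField {k : ℕ} {p₀ : M} {x : E} (hx : x ∈ (extChartAt 𝓘(ℝ, E) p₀).target)
    (v : ∀ p : M, TangentSpace 𝓘(ℝ, E) p) (ω : FormField E M (k + 1)) :
    chartRep p₀ (contractField v ω) x = (chartRep p₀ ω x).curryLeft (vecRep p₀ v x) := by
  have h := ContinuousAlternatingMap.curryLeft_compContinuousLinearMap (E := E) (F := E)
    (ω ((extChartAt 𝓘(ℝ, E) p₀).symm x)) (dChartSymm p₀ x) (vecRep p₀ v x)
  have h' : ∀ a b : E, a = b →
      ((ContinuousAlternatingMap.curryLeft (E := E) (ω ((extChartAt 𝓘(ℝ, E) p₀).symm x))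
        a).compContinuousLinearMap (dChartSymm p₀ x) : E [⋀^Fin k]→L[ℝ] ℝ) =
      (ContinuousAlternatingMap.curryLeft (E := E) (ω ((extChartAt 𝓘(ℝ, E) p₀).symm x))
        b).compContinuousLinearMap (dChartSymm p₀ x) := by
    rintro a _ rfl; rfl
  exact (h.trans (h' _ _ (dChartSymm_vecRep hx v))).symm

variable (E M) in
/-- `𝔛(M)`: the smooth vector fields. -/
abbrev VField : Type _ := ContMDiffSection 𝓘(ℝ, E) E smooth (TangentSpace 𝓘(ℝ, E) : M → Type _)

variable [FiniteDimensional ℝ E]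

lemma contDiffOn_vecRep (p₀ : M) (v : VField E M) :
    ContDiffOn ℝ smooth (vecRep p₀ v) (extChartAt 𝓘(ℝ, E) p₀).target := by
  have : CompleteSpace E := FiniteDimensional.complete ℝ E
  intro x hx
  have h1 : ContMDiffWithinAt 𝓘(ℝ, E) 𝓘(ℝ, E).tangent smooth
      (fun y => (Bundle.TotalSpace.mk' E y (VectorField.mpullbackWithin 𝓘(ℝ, E) 𝓘(ℝ, E)
        (extChartAt 𝓘(ℝ, E) p₀).symm v (Set.range 𝓘(ℝ, E)) y) : TangentBundle 𝓘(ℝ, E) E))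
      (Set.range 𝓘(ℝ, E) ∩ (extChartAt 𝓘(ℝ, E) p₀).symm ⁻¹' Set.univ) x := by
    refine ContMDiffWithinAt.mpullbackWithin_vectorField_inter (n := smooth)
      (v.contMDiff _).contMDiffWithinAt (contMDiffWithinAt_extChartAt_symm_range p₀ hx)
      (isInvertible_mfderivWithin_extChartAt_symm hx) (by simp)
      (ModelWithCorners.uniqueMDiffOn _) (by simp)
  have h2 := (contMDiff_snd_tangentBundle_modelSpace E 𝓘(ℝ, E) (n := smooth)).contMDiffAt.comp_contMDiffWithinAt x h1
  have h3 := h2.contDiffWithinAt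
  exact h3.mono (by intro y _; simp)

lemma contract_mem {k : ℕ} (v : VField E M) (ω : DiffForm E M (k + 1)) :
    contractField v ω.1 ∈ smoothForms E M k := by
  intro p₀
  have h : ContDiffOn ℝ smooth (fun x => (chartRep p₀ ω.1 x).curryLeft (vecRep p₀ v x))
      (extChartAt 𝓘(ℝ, E) p₀).target := by
    have h0 : ContDiff ℝ smooth (fun a : E [⋀^Fin (k + 1)]→L[ℝ] ℝ => a.curryLeft) := by
      exact LinearIsometry.contDiff (𝕜 := ℝ) (E := E [⋀^Fin (k + 1)]→L[ℝ] ℝ)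
        (F := E →L[ℝ] E [⋀^Fin k]→L[ℝ] ℝ) ContinuousAlternatingMap.curryLeftLI
    have h1 : ContDiffOn ℝ smooth (fun x => (chartRep p₀ ω.1 x).curryLeft)
        (extChartAt 𝓘(ℝ, E) p₀).target := h0.comp_contDiffOn (ω.2 p₀)
    exact h1.clm_apply (contDiffOn_vecRep p₀ v)
  exact h.congr fun x hx => chartRep_contractField hx v ω.1


lemma chartRep_transition {k : ℕ} {p₀ p : M} {x : E} (hx : x ∈ (extChartAt 𝓘(ℝ, E) p₀).target)
    (hp : (extChartAt 𝓘(ℝ, E) p₀).symm x ∈ (extChartAt 𝓘(ℝ, E) p).source) (ω : FormField E M k) :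
    chartRep p₀ ω x =
      (chartRep p ω (extChartAt 𝓘(ℝ, E) p ((extChartAt 𝓘(ℝ, E) p₀).symm x))).compContinuousLinearMap
        (fderiv ℝ (extChartAt 𝓘(ℝ, E) p ∘ (extChartAt 𝓘(ℝ, E) p₀).symm) x) := by
  have h1 : ∀ u : E, fderiv ℝ (extChartAt 𝓘(ℝ, E) p ∘ (extChartAt 𝓘(ℝ, E) p₀).symm) x u =
      dChart p ((extChartAt 𝓘(ℝ, E) p₀).symm x) (dChartSymm p₀ x u) := by
    intro u
    rw [← mfderiv_eq_fderiv, ← mfderivWithin_univ]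
    have hr : Set.range 𝓘(ℝ, E) = Set.univ := by simp
    have := mfderiv_comp_mfderivWithin (I := 𝓘(ℝ, E)) (I' := 𝓘(ℝ, E)) (I'' := 𝓘(ℝ, E))
      (s := Set.range 𝓘(ℝ, E)) x
      (mdifferentiableAt_extChartAt (I := 𝓘(ℝ, E)) (by simpa using hp) :
        MDifferentiableAt 𝓘(ℝ, E) 𝓘(ℝ, E) (extChartAt 𝓘(ℝ, E) p)
          ((extChartAt 𝓘(ℝ, E) p₀).symm x))
      (mdifferentiableWithinAt_extChartAt_symm hx)
      (by rw [hr]; exact uniqueMDiffWithinAt_univ _)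
    have h2 := DFunLike.congr_fun this u
    rw [hr] at h2
    refine h2.trans ?_
    unfold dChart dChartSymm
    rw [hr]
    rfl
  ext u
  set q := (extChartAt 𝓘(ℝ, E) p₀).symm x with hq
  have h3 : ∀ q' (hq' : q' = q), ∀ w w' : Fin k → E, (∀ i, w i = w' i) → ω q w = ω q' w' := by
    rintro q' rfl w w' hw
    congr 1
    funext i
    exact hw i
  refine h3 _ ((extChartAt 𝓘(ℝ, E) p).left_inv hp) _ _ fun i => ?_
  have h4 := dChartSymm_comp_dChart hp (dChartSymm p₀ x (u i))
  refine h4.symm.trans ?_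
  exact congrArg (fun a : E => (dChartSymm p (extChartAt 𝓘(ℝ, E) p q) a : E)) (h1 (u i)).symm

lemma chartRep_extDField_center {k : ℕ} (p : M) (ω : FormField E M k) :
    chartRep p (extDField ω) (extChartAt 𝓘(ℝ, E) p p) =
      extDeriv (chartRep p ω) (extChartAt 𝓘(ℝ, E) p p) := by
  have key : ∀ q (hq : q = p) (A : E →L[ℝ] TangentSpace 𝓘(ℝ, E) q),
      (∀ u : E, dChart p q (A u) = u) →
      ((extDField ω q).compContinuousLinearMap A : E [⋀^Fin (k + 1)]→L[ℝ] ℝ) =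
        extDeriv (chartRep p ω) (extChartAt 𝓘(ℝ, E) p p) := by
    rintro q rfl A hA
    ext u
    have h : (fun i => dChart q q (A (u i))) = u := funext fun i => hA (u i)
    exact congrArg (extDeriv (chartRep q ω) (extChartAt 𝓘(ℝ, E) q q)) h
  exact key _ (extChartAt_to_inv p) _
    (dChart_comp_dChartSymm ((extChartAt 𝓘(ℝ, E) p).map_source (mem_extChartAt_source p)))

/-- The coordinate expression of `dω` in any chart is the exterior derivative of the coordinate
expression of `ω`. -/
lemma chartRep_extDField {k : ℕ} {p₀ : M} {x : E} (hx : x ∈ (extChartAt 𝓘(ℝ, E) p₀).target)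
    (ω : DiffForm E M k) :
    chartRep p₀ (extDField ω.1) x = extDeriv (chartRep p₀ ω.1) x := by
  set p := (extChartAt 𝓘(ℝ, E) p₀).symm x with hp
  have hps : p ∈ (extChartAt 𝓘(ℝ, E) p).source := mem_extChartAt_source p
  have hp0 : extChartAt 𝓘(ℝ, E) p₀ p = x := (extChartAt 𝓘(ℝ, E) p₀).right_inv hx
  have hτ : ContDiffAt ℝ smooth
      (extChartAt 𝓘(ℝ, E) p ∘ (extChartAt 𝓘(ℝ, E) p₀).symm) x := by
    have h := contDiffWithinAt_ext_coord_change (I := 𝓘(ℝ, E)) (n := smooth) p p₀ (y := x)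
      ⟨hx, hps⟩
    rwa [modelWithCornersSelf_coe, Set.range_id, contDiffWithinAt_univ] at h
  have hev : chartRep p₀ ω.1 =ᶠ[𝓝 x] fun y =>
      (chartRep p ω.1 ((extChartAt 𝓘(ℝ, E) p ∘
        (extChartAt 𝓘(ℝ, E) p₀).symm) y)).compContinuousLinearMap
        (fderiv ℝ (extChartAt 𝓘(ℝ, E) p ∘ (extChartAt 𝓘(ℝ, E) p₀).symm) y) := by
    have h1 : ∀ᶠ y in 𝓝 x, y ∈ (extChartAt 𝓘(ℝ, E) p₀).target :=
      (isOpen_extChartAt_target p₀).mem_nhds hx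
    have h2 : ∀ᶠ y in 𝓝 x, (extChartAt 𝓘(ℝ, E) p₀).symm y ∈ (extChartAt 𝓘(ℝ, E) p).source :=
      (continuousAt_extChartAt_symm'' hx).preimage_mem_nhds (extChartAt_source_mem_nhds p)
    filter_upwards [h1, h2] with y hy1 hy2
    exact chartRep_transition hy1 hy2 ω.1
  have hd : DifferentiableAt ℝ (chartRep p ω.1)
      ((extChartAt 𝓘(ℝ, E) p ∘ (extChartAt 𝓘(ℝ, E) p₀).symm) x) :=
    ((ω.2 p).contDiffAt ((isOpen_extChartAt_target p).mem_nhds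
      ((extChartAt 𝓘(ℝ, E) p).map_source hps))).differentiableAt (by simp)
  have h2 : (2 : WithTop ℕ∞) ≤ smooth := WithTop.coe_le_coe.2 le_top
  rw [hev.extDeriv_eq, extDeriv_pullback hd hτ (by simpa using h2),
    chartRep_transition hx hps (extDField ω.1)]
  congr 1
  exact chartRep_extDField_center p ω.1

lemma extD_mem {k : ℕ} (ω : DiffForm E M k) : extDField ω.1 ∈ smoothForms E M (k + 1) := by
  intro p₀
  have h : ContDiffOn ℝ smooth (extDeriv (chartRep p₀ ω.1)) (extChartAt 𝓘(ℝ, E) p₀).target := by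
    have h1 : ContDiffOn ℝ smooth (fderiv ℝ (chartRep p₀ ω.1)) (extChartAt 𝓘(ℝ, E) p₀).target :=
      (ω.2 p₀).fderiv_of_isOpen (isOpen_extChartAt_target p₀) (by simp)
    have h2 : ContDiff ℝ smooth
        (fun a : E →L[ℝ] E [⋀^Fin k]→L[ℝ] ℝ => ContinuousAlternatingMap.alternatizeUncurryFin a) :=
      ContinuousLinearMap.contDiff (𝕜 := ℝ) (E := E →L[ℝ] E [⋀^Fin k]→L[ℝ] ℝ)
        (F := E [⋀^Fin (k + 1)]→L[ℝ] ℝ) (ContinuousAlternatingMap.alternatizeUncurryFinCLM ℝ E ℝ)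
    exact h2.comp_contDiffOn h1
  exact h.congr fun x hx => chartRep_extDField hx ω

variable (E M) in
/-- The exterior derivative `d : Ω^k(M) → Ω^{k+1}(M)`. -/
def extD (k : ℕ) : DiffForm E M k →ₗ[ℝ] DiffForm E M (k + 1) where
  toFun ω := ⟨extDField ω.1, extD_mem ω⟩
  map_add' a b := by
    refine Subtype.ext (funext fun p => ?_)
    have hx := (extChartAt 𝓘(ℝ, E) p).map_source (mem_extChartAt_source p)
    have hn := (isOpen_extChartAt_target (I := 𝓘(ℝ, E)) p).mem_nhds hx
    have ha := (((a.2 p).contDiffAt hn).differentiableAt (by simp))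
    have hb := (((b.2 p).contDiffAt hn).differentiableAt (by simp))
    have h := extDeriv_add ha hb
    exact congrArg (fun c => c.compContinuousLinearMap (dChart p p)) h
  map_smul' c a := by
    refine Subtype.ext (funext fun p => ?_)
    have h := extDeriv_smul c (chartRep p a.1) (x := extChartAt 𝓘(ℝ, E) p p)
    exact congrArg (fun c => c.compContinuousLinearMap (dChart p p)) h

/-- The contraction `ι_v : Ω^{k+1}(M) → Ω^k(M)`, linear in `v`. -/
def contract (k : ℕ) : VField E M →ₗ[ℝ] DiffForm E M (k + 1) →ₗ[ℝ] DiffForm E M k :=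
  LinearMap.mk₂ ℝ (fun v ω => ⟨contractField v ω.1, contract_mem v ω⟩)
    (fun v w ω => Subtype.ext (funext fun p =>
      (ContinuousAlternatingMap.curryLeft (E := E) (ω.1 p)).map_add (v p) (w p)))
    (fun c v ω => Subtype.ext (funext fun p =>
      (ContinuousAlternatingMap.curryLeft (E := E) (ω.1 p)).map_smul c (v p)))
    (fun _ _ _ => rfl) (fun _ _ _ => rfl)

/-- The Lie bracket of vector fields. -/
def vbracket (v w : VField E M) : VField E M where
  toFun := VectorField.mlieBracket 𝓘(ℝ, E) v w
  contMDiff_toFun := by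
    have : CompleteSpace E := FiniteDimensional.complete ℝ E
    have h2 : (minSmoothness ℝ 2) ≤ smooth := by
      have h : (2 : WithTop ℕ∞) ≤ smooth := WithTop.coe_le_coe.2 le_top
      simpa using h
    have : IsManifold 𝓘(ℝ, E) (((⊤ : ℕ∞) : WithTop ℕ∞) + 1) M := by
      have e : ((⊤ : ℕ∞) : WithTop ℕ∞) + 1 = smooth := rfl
      rw [e]
      infer_instance
    have : IsManifold 𝓘(ℝ, E) (minSmoothness ℝ 2) M := IsManifold.of_le h2
    exact ContDiff.mlieBracket_vectorField (m := ⊤) (n := ⊤) v.contMDiff w.contMDiff (by simp)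

lemma extD_extD {k : ℕ} (ω : DiffForm E M k) : extD E M (k + 1) (extD E M k ω) = 0 := by
  refine Subtype.ext (funext fun p => ?_)
  have hx := (extChartAt 𝓘(ℝ, E) p).map_source (mem_extChartAt_source p)
  have hn := (isOpen_extChartAt_target (I := 𝓘(ℝ, E)) p).mem_nhds hx
  have he : chartRep p (extDField ω.1) =ᶠ[𝓝 (extChartAt 𝓘(ℝ, E) p p)]
      extDeriv (chartRep p ω.1) := by
    filter_upwards [hn] with y hy using chartRep_extDField hy ω
  have h2 : (2 : WithTop ℕ∞) ≤ smooth := WithTop.coe_le_coe.2 le_top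
  have h := he.extDeriv_eq.trans (extDeriv_extDeriv_apply ((ω.2 p).contDiffAt hn) (by simpa using h2))
  exact congrArg (fun c => c.compContinuousLinearMap (dChart p p)) h

/-- For `dω = 0`, `d(ι_v ω) = 0` and `d(ι_w ω) = 0` one has `d(ι_w ι_v ω) = - ι_{[v, w]} ω`. -/
lemma extD_contract_contract {k : ℕ} {v w : VField E M} {ω : DiffForm E M (k + 2)}
    (h0 : extD E M _ ω = 0) (hv : extD E M _ (contract _ v ω) = 0)
    (hw : extD E M _ (contract _ w ω) = 0) :
    extD E M _ (contract _ w (contract _ v ω)) = - contract _ (vbracket v w) ω := by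
  refine Subtype.ext (funext fun p => ?_)
  set x := extChartAt 𝓘(ℝ, E) p p with hxdef
  have hx : x ∈ (extChartAt 𝓘(ℝ, E) p).target :=
    (extChartAt 𝓘(ℝ, E) p).map_source (mem_extChartAt_source p)
  have hn := (isOpen_extChartAt_target (I := 𝓘(ℝ, E)) p).mem_nhds hx
  have hz : ∀ {j : ℕ} (η : DiffForm E M j), extD E M j η = 0 → extDeriv (chartRep p η.1) x = 0 := by
    intro j η h
    rw [← chartRep_extDField hx η]
    have : extDField η.1 = 0 := congrArg Subtype.val h
    rw [this]
    rfl
  have hc : ∀ {j : ℕ} (u : VField E M) (η : DiffForm E M (j + 1)),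
      chartRep p (contract j u η).1 =ᶠ[𝓝 x]
        fun y => (chartRep p η.1 y).curryLeft (vecRep p u y) := by
    intro j u η
    filter_upwards [hn] with y hy using chartRep_contractField hy u η.1
  have hdV : ∀ u : VField E M, DifferentiableAt ℝ (vecRep p u) x := fun u =>
    ((contDiffOn_vecRep p u).contDiffAt hn).differentiableAt (by simp)
  have hdω : DifferentiableAt ℝ (chartRep p ω.1) x :=
    ((ω.2 p).contDiffAt hn).differentiableAt (by simp)
  have hcc : chartRep p (contract k w (contract (k + 1) v ω)).1 =ᶠ[𝓝 x]
        fun y => ((chartRep p ω.1 y).curryLeft (vecRep p v y)).curryLeft (vecRep p w y) := by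
    filter_upwards [hn] with y hy
    refine (chartRep_contractField hy w _).trans ?_
    exact congrArg (fun a => ContinuousAlternatingMap.curryLeft a (vecRep p w y))
      (chartRep_contractField hy v ω.1)
  have h := extDeriv_contract_contract (hdV w) (hdV v) hdω (hz _ h0)
    ((hc v ω).extDeriv_eq.symm.trans (hz _ hv)) ((hc w ω).extDeriv_eq.symm.trans (hz _ hw))
  have hbr : dChart p p (vbracket v w p) =
      VectorField.lieBracket ℝ (vecRep p v) (vecRep p w) x := by
    have h1 := (isInvertible_mfderiv_extChartAt (I := 𝓘(ℝ, E))
      (mem_extChartAt_source (I := 𝓘(ℝ, E)) p)).self_apply_inverse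
      (VectorField.lieBracketWithin ℝ (E := E) (vecRep p v) (vecRep p w)
        ((extChartAt 𝓘(ℝ, E) p).symm ⁻¹' Set.univ ∩ Set.range 𝓘(ℝ, E)) x)
    have h2 : ((extChartAt 𝓘(ℝ, E) p).symm ⁻¹' Set.univ ∩ Set.range 𝓘(ℝ, E)) = Set.univ := by
      simp
    have h3 := congrArg (fun s => VectorField.lieBracketWithin ℝ (vecRep p v) (vecRep p w) s x) h2
    simp only [VectorField.lieBracketWithin_univ] at h3
    exact h1.trans h3
  rw [← hcc.extDeriv_eq, ← hbr] at h
  refine ContinuousAlternatingMap.ext fun u => ?_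
  refine (congrArg (fun c => c (fun i => dChart p p (u i))) h).trans ?_
  refine congrArg Neg.neg ?_
  refine Eq.trans ?_ (eq_chartRep p ω.1 (Matrix.vecCons (vbracket v w p) u)).symm
  refine congrArg (chartRep p ω.1 x) ?_
  funext i
  refine Fin.cases rfl (fun i => rfl) i

lemma vbracket_add_left (v v' w : VField E M) :
    vbracket (v + v') w = vbracket v w + vbracket v' w := by
  have : CompleteSpace E := FiniteDimensional.complete ℝ E
  have : IsManifold 𝓘(ℝ, E) 2 M :=
    IsManifold.of_le (n := smooth) (WithTop.coe_le_coe.2 le_top)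
  ext p
  exact VectorField.mlieBracket_add_left (v.mdifferentiable p)
    (v'.mdifferentiable p)

lemma vbracket_smul_left (c : ℝ) (v w : VField E M) : vbracket (c • v) w = c • vbracket v w := by
  have : CompleteSpace E := FiniteDimensional.complete ℝ E
  have : IsManifold 𝓘(ℝ, E) 2 M :=
    IsManifold.of_le (n := smooth) (WithTop.coe_le_coe.2 le_top)
  ext p
  exact VectorField.mlieBracket_const_smul_left (v.mdifferentiable p)

lemma vbracket_swap (v w : VField E M) : vbracket v w = - vbracket w v := by
  ext p
  exact VectorField.mlieBracket_swap_apply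

lemma vbracket_add_right (v w w' : VField E M) :
    vbracket v (w + w') = vbracket v w + vbracket v w' := by
  rw [vbracket_swap, vbracket_add_left, vbracket_swap v w, vbracket_swap v w', neg_add]

lemma vbracket_smul_right (c : ℝ) (v w : VField E M) : vbracket v (c • w) = c • vbracket v w := by
  rw [vbracket_swap, vbracket_smul_left, vbracket_swap v w, smul_neg]

lemma contract_contract_self {k : ℕ} (v : VField E M) (ω : DiffForm E M (k + 2)) :
    contract k v (contract (k + 1) v ω) = 0 :=
  Subtype.ext (funext fun p => ContinuousAlternatingMap.curryLeft_same (E := E) (ω.1 p) (v p))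

variable (E M) in
/-- The product of all the spaces `Ω^k(M)`. -/
abbrev TotalForms : Type _ := ∀ k : ℕ, DiffForm E M k

/-- The form `τ ∈ Ω^k(M)` as an element of the product of all the spaces of forms. -/
abbrev ofForm {k : ℕ} (τ : DiffForm E M k) : TotalForms E M := Pi.single k τ

variable (E M) in
/-- The exterior derivative on forms of all degrees. -/
def dTot (α : TotalForms E M) : TotalForms E M
  | 0 => 0
  | k + 1 => extD E M k (α k)

/-- The contraction on forms of all degrees; it vanishes on functions. -/
def iota : VField E M →ₗ[ℝ] Module.End ℝ (TotalForms E M) :=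
  LinearMap.mk₂ ℝ (fun v α k => contract k v (α (k + 1)))
    (fun v w α => funext fun k => by simp) (fun c v α => funext fun k => by simp)
    (fun v α β => funext fun k => by simp) (fun c v α => funext fun k => by simp)

/-- The iterated contraction `ι_{v_k} ∘ ⋯ ∘ ι_{v_1}`. -/
def iotas : (k : ℕ) → (Fin k → VField E M) → Module.End ℝ (TotalForms E M)
  | 0, _ => 1
  | k + 1, v => iotas k (fun i => v i.succ) * iota (v 0)

lemma iota_sq (v : VField E M) : iota v * iota v = 0 :=
  LinearMap.ext fun _ => funext fun _ => contract_contract_self v _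

/-- The iterated contraction as an alternating function of the vector fields. -/
def iotasAlt (k : ℕ) : VField E M [⋀^Fin k]→ₗ[ℝ] Module.End ℝ (TotalForms E M) :=
  (((MulOpposite.opLinearEquiv ℝ).symm.toLinearMap).comp
    (ExteriorAlgebra.lift ℝ ⟨((MulOpposite.opLinearEquiv ℝ).toLinearMap).comp iota, fun v => by
      change MulOpposite.op (iota v) * MulOpposite.op (iota v) = 0
      rw [← MulOpposite.op_mul, iota_sq, MulOpposite.op_zero]⟩).toLinearMap).compAlternatingMap (ExteriorAlgebra.ιMulti ℝ k)

lemma iotasAlt_apply (k : ℕ) (v : Fin k → VField E M) : iotasAlt k v = iotas k v := by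
  induction k with
  | zero => simp [iotasAlt, iotas]
  | succ k ih =>
    rw [iotas, ← ih]
    simp [iotasAlt, ExteriorAlgebra.ιMulti_succ_apply, Matrix.vecTail, Function.comp_def]

lemma iotas_apply_eq_zero {k N j : ℕ} (h : j + k ≠ N) (v : Fin k → VField E M)
    {α : TotalForms E M} (hα : ∀ i, i ≠ N → α i = 0) : iotas k v α j = 0 := by
  induction k generalizing N α with
  | zero => exact hα _ (by simpa using h)
  | succ k ih =>
    by_cases hN : N = 0
    · subst hN
      have : iota (v 0) α = 0 := by
        funext i
        have : α (i + 1) = 0 := hα _ (by simp)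
        simp [iota, this]
      change (iotas k _ (iota (v 0) α)) j = 0
      rw [this]; simp
    · obtain ⟨N, rfl⟩ := Nat.exists_eq_succ_of_ne_zero hN
      refine ih (N := N) (by omega) _ fun i hi => ?_
      have : α (i + 1) = 0 := hα _ (by omega)
      simp [iota, this]

end Charts
end Forms

section LInfinity

/-- The Koszul sign `ε(σ; x₁, …, x_n)` for homogeneous elements `x_i` of degrees `d i`. -/
def koszulSign {n : ℕ} (σ : Equiv.Perm (Fin n)) (d : Fin n → ℤ) : ℤˣ :=
  ∏ a : Fin n, ∏ b : Fin n, if a < b ∧ σ b < σ a then (d (σ a) * d (σ b)).negOnePow else 1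

lemma koszulSign_zero {n : ℕ} (σ : Equiv.Perm (Fin n)) (d : Fin n → ℤ) (hd : ∀ i, d i = 0) :
    koszulSign σ d = 1 := by
  simp [koszulSign, hd]

lemma isInternal_of_proj {V : Type*} [AddCommGroup V] [Module ℝ V] (gr : ℤ → Submodule ℝ V)
    (π : ℤ → V →ₗ[ℝ] V) (hmem : ∀ j x, π j x ∈ gr j) (hself : ∀ j, ∀ x ∈ gr j, π j x = x)
    (hne : ∀ i j, i ≠ j → ∀ x ∈ gr i, π j x = 0) (s : Finset ℤ) (hs : ∀ x, ∑ j ∈ s, π j x = x) :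
    DirectSum.IsInternal gr := by
  rw [DirectSum.isInternal_submodule_iff_iSupIndep_and_iSup_eq_top]
  constructor
  · rw [iSupIndep_def]
    intro j
    rw [Submodule.disjoint_def]
    intro x hx hx'
    have h : (⨆ i, ⨆ (_ : i ≠ j), gr i) ≤ LinearMap.ker (π j) :=
      iSup₂_le fun i hi y hy => hne i j hi y hy
    rw [← hself j x hx]
    exact h hx'
  · rw [eq_top_iff]
    intro x _
    rw [← hs x]
    exact Submodule.sum_mem _ fun j _ => Submodule.mem_iSup_of_mem j (hmem j x)

/-- A graded real vector space `V = ⨁ gr i` with a family of graded skew-symmetric multilinear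
brackets `l k`, `k ≥ 1`, of degree `2 - k`: the operations of an `L_∞`-algebra. (The value `l 0` is
normalised to be zero and plays no role.) -/
structure GradedBrackets (V : Type*) [AddCommGroup V] [Module ℝ V] where
  gr : ℤ → Submodule ℝ V
  isInternal : DirectSum.IsInternal gr
  l : (k : ℕ) → MultilinearMap ℝ (fun _ : Fin k => V) V
  l_zero : l 0 = 0
  l_mem : ∀ (k : ℕ) (d : Fin k → ℤ) (x : Fin k → V), (∀ i, x i ∈ gr (d i)) →
    l k x ∈ gr ((∑ i, d i) + (2 - (k : ℤ)))
  l_skew : ∀ (k : ℕ) (σ : Equiv.Perm (Fin k)) (d : Fin k → ℤ) (x : Fin k → V),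
    (∀ i, x i ∈ gr (d i)) →
    l k (fun i => x (σ i)) = (Equiv.Perm.sign σ * koszulSign σ d) • l k x

/-- `(i, n - i)`-unshuffles: permutations which are increasing on the first `i` and on the last
`n - i` indices. -/
def IsUnshuffle {n : ℕ} (i : ℕ) (σ : Equiv.Perm (Fin n)) : Prop :=
  (∀ a b : Fin n, a < b → (b : ℕ) < i → σ a < σ b) ∧
    ∀ a b : Fin n, i ≤ (a : ℕ) → a < b → σ a < σ b

/-- For a composition `n = k₁ + ⋯ + k_p`: the `(k₁, …, k_p)`-unshuffles, that is, permutations which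
are increasing on each block, such that moreover the values at the first elements of two consecutive
blocks are increasing whenever these two blocks have the same size. -/
def IsBlockUnshuffle {n : ℕ} (c : Composition n) (σ : Equiv.Perm (Fin n)) : Prop :=
  (∀ i : Fin c.length, StrictMono fun t => σ (c.embedding i t)) ∧
    ∀ i j : Fin c.length, (j : ℕ) = i + 1 → c.blocksFun i = c.blocksFun j →
      σ (c.embedding i ⟨0, c.blocks_pos' i i.2⟩) < σ (c.embedding j ⟨0, c.blocks_pos' j j.2⟩)

/-- The exponent
`β = p(p-1)/2 + ∑_i k_i(p-i) + ∑_{j ≥ 2} (k_j - 1) (|x_{σ(1)}| + ⋯ + |x_{σ(k_1+⋯+k_{j-1})}|)`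
for a composition `n = k₁ + ⋯ + k_p` and elements `x_i` of degrees `d i`. -/
def morphismExponent {n : ℕ} (c : Composition n) (σ : Equiv.Perm (Fin n)) (d : Fin n → ℤ) : ℤ :=
  ((c.length * (c.length - 1) / 2 : ℕ) : ℤ) +
    ∑ i : Fin c.length, (c.blocksFun i : ℤ) * ((c.length : ℤ) - (i + 1)) +
    ∑ i : Fin c.length, ((c.blocksFun i : ℤ) - 1) *
      ∑ t : Fin n, if (t : ℕ) < c.sizeUpTo i then d (σ t) else 0

open Classical in
/-- An `L_∞`-morphism: a family of graded skew-symmetric multilinear maps `f k`, `k ≥ 1`, of degree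
`1 - k`, satisfying for all `n ≥ 1` the identity
`∑_{i+j=n+1} ∑_σ ± f_j(l_i(x_{σ(1)}, …, x_{σ(i)}), x_{σ(i+1)}, …, x_{σ(n)}) =`
`∑_{k₁+⋯+k_p=n, k₁≤⋯≤k_p} ∑_σ ± l'_p(f_{k₁}(x_{σ(1)}, …), …, f_{k_p}(…, x_{σ(n)}))`.
In the left hand side below, the arity of the inner bracket is `i + 1` with `0 ≤ i < n`.
(The value `f 0` is normalised to be zero and plays no role.) -/
structure LInftyMorphism {V W : Type*} [AddCommGroup V] [Module ℝ V] [AddCommGroup W] [Module ℝ W]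
    (A : GradedBrackets V) (B : GradedBrackets W) where
  f : (k : ℕ) → MultilinearMap ℝ (fun _ : Fin k => V) W
  f_zero : f 0 = 0
  f_mem : ∀ (k : ℕ) (d : Fin k → ℤ) (x : Fin k → V), (∀ i, x i ∈ A.gr (d i)) →
    f k x ∈ B.gr ((∑ i, d i) + (1 - (k : ℤ)))
  f_skew : ∀ (k : ℕ) (σ : Equiv.Perm (Fin k)) (d : Fin k → ℤ) (x : Fin k → V),
    (∀ i, x i ∈ A.gr (d i)) →
    f k (fun i => x (σ i)) = (Equiv.Perm.sign σ * koszulSign σ d) • f k x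
  map_brackets : ∀ (n : ℕ), 1 ≤ n → ∀ (d : Fin n → ℤ) (x : Fin n → V),
    (∀ i, x i ∈ A.gr (d i)) →
    (∑ i : Fin n, ∑ σ : Equiv.Perm (Fin n) with IsUnshuffle (i + 1) σ,
      ((-1 : ℤˣ) ^ (((i : ℕ) + 1) * (n - i + 1)) * Equiv.Perm.sign σ * koszulSign σ d) •
        f (n - i) (fun t : Fin (n - i) =>
          if (t : ℕ) = 0 then
            A.l (i + 1) (fun s : Fin (i + 1) => x (σ ⟨s, by omega⟩))
          else x (σ ⟨i + t, by omega⟩))) =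
    ∑ c : Composition n with Monotone c.blocksFun,
      ∑ σ : Equiv.Perm (Fin n) with IsBlockUnshuffle c σ,
        ((morphismExponent c σ d).negOnePow * Equiv.Perm.sign σ * koszulSign σ d) •
          B.l c.length (fun i => f (c.blocksFun i) (fun t => x (σ (c.embedding i t))))

/-- A bilinear map as a multilinear map with two arguments. -/
def ofBilinear {V W : Type*} [AddCommGroup V] [Module ℝ V] [AddCommGroup W] [Module ℝ W]
    (B : V →ₗ[ℝ] V →ₗ[ℝ] W) : MultilinearMap ℝ (fun _ : Fin 2 => V) W where
  toFun x := B (x 0) (x 1)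
  map_update_add' x i a b := by
    fin_cases i <;> simp [Function.update]
  map_update_smul' x i c a := by
    fin_cases i <;> simp [Function.update]

lemma ofBilinear_skew {V W : Type*} [AddCommGroup V] [Module ℝ V] [AddCommGroup W] [Module ℝ W]
    (B : V →ₗ[ℝ] V →ₗ[ℝ] W) (hB : ∀ a b, B a b = - B b a) (σ : Equiv.Perm (Fin 2))
    (x : Fin 2 → V) :
    ofBilinear B (fun i => x (σ i)) = Equiv.Perm.sign σ • ofBilinear B x := by
  have h : σ = 1 ∨ σ = Equiv.swap 0 1 := by
    revert σ; decide
  rcases h with rfl | rfl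
  · simp
  · rw [Equiv.Perm.sign_swap (by decide)]
    simpa [ofBilinear] using hB (x 1) (x 0)

/-- A Lie algebra as a graded space concentrated in degree zero, with its Lie bracket as the only
nonzero bracket. -/
def lieBrackets (𝔤 : Type*) [LieRing 𝔤] [LieAlgebra ℝ 𝔤] : GradedBrackets 𝔤 where
  gr i := if i = 0 then ⊤ else ⊥
  isInternal := by
    refine isInternal_of_proj _ (fun j => if j = 0 then LinearMap.id else 0) ?_ ?_ ?_ {0} ?_
    · intro j x; split_ifs <;> simp
    · intro j x hx; split_ifs at hx ⊢ <;> simp_all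
    · intro i j hij x hx
      by_cases h : j = 0
      · subst h; simp_all
      · simp [h]
    · intro x; simp
  l
    | 2 => ofBilinear (LinearMap.mk₂ ℝ (fun X Y : 𝔤 => ⁅X, Y⁆) add_lie smul_lie lie_add
        (fun c X Y => lie_smul c X Y))
    | _ => 0
  l_zero := rfl
  l_mem := by
    intro k d x hx
    by_cases hk : k = 2
    · subst hk
      by_cases h0 : d 0 = 0
      · by_cases h1 : d 1 = 0
        · simp [h0, h1]
        · have hx1 : x 1 = 0 := by have := hx 1; rw [if_neg h1] at this; simpa using this
          simp [ofBilinear, hx1]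
      · have hx0 : x 0 = 0 := by have := hx 0; rw [if_neg h0] at this; simpa using this
        simp [ofBilinear, hx0]
    · match k, hk with
      | 0, _ => exact Submodule.zero_mem _
      | 1, _ => exact Submodule.zero_mem _
      | k + 3, _ => exact Submodule.zero_mem _
  l_skew := by
    intro k σ d x hx
    by_cases hk : k = 2
    · subst hk
      by_cases hd : ∀ i, d i = 0
      · rw [koszulSign_zero σ d hd, mul_one]
        exact ofBilinear_skew _ (fun a b => (lie_skew a b).symm) σ x
      · push Not at hd
        obtain ⟨i, hi⟩ := hd
        have hxi : x i = 0 := by have := hx i; rw [if_neg hi] at this; simpa using this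
        rw [MultilinearMap.map_coord_zero _ (σ.symm i) (by simpa using hxi),
          MultilinearMap.map_coord_zero _ i hxi, smul_zero]
    · match k, hk with
      | 0, _ => simp
      | 1, _ => simp
      | k + 3, _ => simp

end LInfinity

section Observables

variable {E : Type*} [NormedAddCommGroup E] [NormedSpace ℝ E] [FiniteDimensional ℝ E]
  {M : Type*} [TopologicalSpace M] [ChartedSpace E M] [IsManifold 𝓘(ℝ, E) smooth M]
  {n : ℕ}

/-- The space of observables `L(M, ω) = L_0 ⊕ L_{-1} ⊕ ⋯ ⊕ L_{1-n}` of an `(n+1)`-form `ω`. An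
element is a pair `(v, α)` of a vector field `v` and a family `α = (α_0, …, α_{n-1})` of forms of
degrees `0, …, n - 1` with `dα_{n-1} = -ι_v ω`. The pairs `(v, α_{n-1})` form `L_0`, and `α_k` for
`k < n - 1` is the component in `L_{k-(n-1)} = Ω^k(M)`. -/
def Observables (ω : DiffForm E M (n + 1)) : Submodule ℝ (VField E M × TotalForms E M) where
  carrier := {x | (∀ k, n ≤ k → x.2 k = 0) ∧ dTot E M x.2 n = - contract n x.1 ω}
  add_mem' := by
    rintro x y ⟨hx, hx'⟩ ⟨hy, hy'⟩
    refine ⟨fun k hk => by simp [hx k hk, hy k hk], ?_⟩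
    have h : dTot E M (x + y).2 n = dTot E M x.2 n + dTot E M y.2 n := by
      cases n <;> simp [dTot]
    rw [h, hx', hy']
    simp [add_comm]
  zero_mem' := ⟨fun _ _ => rfl, by cases n <;> simp [dTot]⟩
  smul_mem' := by
    rintro c x ⟨hx, hx'⟩
    refine ⟨fun k hk => by simp [hx k hk], ?_⟩
    have h : dTot E M (c • x).2 n = c • dTot E M x.2 n := by
      cases n <;> simp [dTot]
    rw [h, hx']
    simp

variable (ω : DiffForm E M (n + 1))

/-- The projection `π_𝔛 : L(M, ω) → 𝔛(M)`, `(v, α) ↦ v` (it vanishes in nonzero degrees). -/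
def obsVec : Observables ω →ₗ[ℝ] VField E M :=
  (LinearMap.fst ℝ _ _).comp (Observables ω).subtype

/-- The homogeneous components: `L_0 = {(v, α) | α ∈ Ω^{n-1}(M), dα = -ι_v ω}` and
`L_j = {(0, α) | α ∈ Ω^{n-1+j}(M)}` for `j < 0`. -/
def obsGr (j : ℤ) : Submodule ℝ (Observables ω) where
  carrier := {x | (j ≠ 0 → x.1.1 = 0) ∧ ∀ k : ℕ, (k : ℤ) ≠ n - 1 + j → x.1.2 k = 0}
  add_mem' := by
    rintro x y ⟨hx, hx'⟩ ⟨hy, hy'⟩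
    exact ⟨fun h => by simp [hx h, hy h], fun k hk => by simp [hx' k hk, hy' k hk]⟩
  zero_mem' := ⟨fun _ => rfl, fun _ _ => rfl⟩
  smul_mem' := by
    rintro c x ⟨hx, hx'⟩
    exact ⟨fun h => by simp [hx h], fun k hk => by simp [hx' k hk]⟩

/-- The projection onto the component of degree `j`. -/
def obsProj (j : ℤ) : Observables ω →ₗ[ℝ] Observables ω where
  toFun x := ⟨(if j = 0 then x.1.1 else 0, fun k => if (k : ℤ) = n - 1 + j then x.1.2 k else 0), by
    refine ⟨fun k hk => by simp [x.2.1 k hk], ?_⟩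
    have h := x.2.2
    cases n with
    | zero => split_ifs <;> simp_all [dTot]
    | succ m =>
      simp only [dTot] at h ⊢
      by_cases hj : j = 0
      · simp [hj, h]
      · simp [hj]⟩
  map_add' x y := by
    refine Subtype.ext (Prod.ext ?_ (funext fun k => ?_))
    · by_cases h : j = 0 <;> simp [h]
    · by_cases h : (k : ℤ) = n - 1 + j <;> simp [h]
  map_smul' c x := by
    refine Subtype.ext (Prod.ext ?_ (funext fun k => ?_))
    · by_cases h : j = 0 <;> simp [h]
    · by_cases h : (k : ℤ) = n - 1 + j <;> simp [h]

lemma obs_isInternal : DirectSum.IsInternal (obsGr ω) := by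
  refine isInternal_of_proj _ (obsProj ω) ?_ ?_ ?_ (Finset.Icc (-n : ℤ) 0) ?_
  · intro j x
    exact ⟨fun h => by simp [obsProj, h], fun k hk => by simp [obsProj, hk]⟩
  · rintro j x ⟨h1, h2⟩
    refine Subtype.ext (Prod.ext ?_ (funext fun k => ?_))
    · by_cases h : j = 0
      · simp [obsProj, h]
      · simp [obsProj, h, h1 h]
    · by_cases h : (k : ℤ) = n - 1 + j
      · simp [obsProj, h]
      · simp [obsProj, h, h2 k h]
  · rintro i j hij x ⟨h1, h2⟩
    refine Subtype.ext (Prod.ext ?_ (funext fun k => ?_))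
    · by_cases h : j = 0
      · simp [obsProj, h, h1 (by omega)]
      · simp [obsProj, h]
    · by_cases h : (k : ℤ) = n - 1 + j
      · simp [obsProj, h, h2 k (by omega)]
      · simp [obsProj, h]
  · intro x
    refine Subtype.ext (Prod.ext ?_ (funext fun k => ?_))
    · simp [obsProj, Prod.fst_sum, Finset.sum_ite_eq']
    · have : ∀ j : ℤ, (k : ℤ) = n - 1 + j ↔ j = k - n + 1 := by intro j; omega
      simp only [obsProj, LinearMap.coe_mk, AddHom.coe_mk, AddSubmonoidClass.coe_finsetSum,
        Prod.snd_sum, Finset.sum_apply, this, Finset.sum_ite_eq']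
      split_ifs with h
      · rfl
      · refine (x.2.1 k ?_).symm
        simp only [Finset.mem_Icc, not_and_or, not_le] at h
        omega

/-- The unary bracket: `l_1 α = dα` on forms of degree `< n - 1` (for forms of degree `n - 2` this is
`(0, dα) ∈ L_0`), and `l_1 = 0` on `L_0`. -/
def obsL1 : Observables ω →ₗ[ℝ] Observables ω where
  toFun x := ⟨(0, fun k => if k < n then dTot E M x.1.2 k else 0), by
    refine ⟨fun k hk => by simp [hk], ?_⟩
    match n with
    | 0 => simp [dTot]
    | 1 => simp [dTot]
    | m + 2 => simp [dTot, extD_extD]⟩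
  map_add' x y := by
    refine Subtype.ext (Prod.ext (by simp) (funext fun k => ?_))
    by_cases h : k < n <;> cases k <;> simp [h, dTot]
  map_smul' c x := by
    refine Subtype.ext (Prod.ext (by simp) (funext fun k => ?_))
    by_cases h : k < n <;> cases k <;> simp [h, dTot]

lemma ofForm_ne {N : ℕ} (τ : DiffForm E M N) (i : ℕ) (hi : i ≠ N) : ofForm τ i = 0 := by
  simp [ofForm, hi]

variable {ω} in
lemma obs_contract_closed (hn : 1 ≤ n) (x : Observables ω) :
    extD E M n (contract n x.1.1 ω) = 0 := by
  obtain ⟨m, rfl⟩ : ∃ m, n = m + 1 := ⟨n - 1, by omega⟩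
  have h := x.2.2
  simp only [dTot] at h
  rw [← neg_eq_zero, ← map_neg, ← h, extD_extD]

/-- The binary bracket `l_2((v, α), (w, β)) = ([v, w], ι_w ι_v ω)`. -/
def obsL2 (hn : 1 ≤ n) (hω : extD E M (n + 1) ω = 0) :
    Observables ω →ₗ[ℝ] Observables ω →ₗ[ℝ] Observables ω :=
  LinearMap.mk₂ ℝ
    (fun x y => ⟨(vbracket x.1.1 y.1.1, iota y.1.1 (iota x.1.1 (ofForm ω))), by
      obtain ⟨m, rfl⟩ : ∃ m, n = m + 1 := ⟨n - 1, by omega⟩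
      constructor
      · intro k hk
        have h : ofForm ω (k + 2) = 0 := ofForm_ne ω _ (by omega)
        simp [iota, h]
      · have h := extD_contract_contract hω (obs_contract_closed hn x) (obs_contract_closed hn y)
        simp only [dTot, iota]
        simpa using h⟩)
    (fun x x' y => Subtype.ext (Prod.ext (by simp [vbracket_add_left]) (by simp)))
    (fun c x y => Subtype.ext (Prod.ext (by simp [vbracket_smul_left]) (by simp)))
    (fun x y y' => Subtype.ext (Prod.ext (by simp [vbracket_add_right]) (by simp)))
    (fun c x y => Subtype.ext (Prod.ext (by simp [vbracket_smul_right]) (by simp)))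

/-- The higher brackets
`l_k((v₁, α₁), …, (v_k, α_k)) = -(-1)^{k(k+1)/2} ι_{v_k} ⋯ ι_{v_1} ω`, `k ≥ 3`. -/
def obsLHigher (k : ℕ) (hk : 3 ≤ k) :
    MultilinearMap ℝ (fun _ : Fin k => Observables ω) (Observables ω) where
  toFun x := ⟨(0, (-(-1 : ℝ) ^ (k * (k + 1) / 2)) • iotas k (fun i => (x i).1.1) (ofForm ω)), by
    have h : ∀ j, j + k ≠ n + 1 → iotas k (fun i => (x i).1.1) (ofForm ω) j = 0 :=
      fun j hj => iotas_apply_eq_zero hj _ (ofForm_ne ω)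
    constructor
    · intro j hj
      simp [h j (by omega)]
    · cases n with
      | zero => simp [dTot]
      | succ m => simp [dTot, h m (by omega)]⟩
  map_update_add' x i a b := by
    refine Subtype.ext (Prod.ext (by simp) ?_)
    have e : ∀ c : Observables ω, (fun j => (Function.update x i c j).1.1) =
        Function.update (fun j => (x j).1.1) i c.1.1 := by
      intro c; funext j; by_cases h : j = i
      · subst h; simp
      · simp [h]
    have h := (iotasAlt (E := E) (M := M) k).map_update_add (fun j => (x j).1.1) i a.1.1 b.1.1
    simp only [iotasAlt_apply] at h
    simp [e, h]
  map_update_smul' x i c a := by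
    refine Subtype.ext (Prod.ext (by simp) ?_)
    have e : ∀ c : Observables ω, (fun j => (Function.update x i c j).1.1) =
        Function.update (fun j => (x j).1.1) i c.1.1 := by
      intro c; funext j; by_cases h : j = i
      · subst h; simp
      · simp [h]
    have h := (iotasAlt (E := E) (M := M) k).map_update_smul (fun j => (x j).1.1) i c a.1.1
    simp only [iotasAlt_apply] at h
    simp [e, h, smul_comm c]

/-- The brackets of the Lie `n`-algebra of observables. -/
def obsBracket (hn : 1 ≤ n) (hω : extD E M (n + 1) ω = 0) :
    (k : ℕ) → MultilinearMap ℝ (fun _ : Fin k => Observables ω) (Observables ω)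
  | 0 => 0
  | 1 => MultilinearMap.ofSubsingleton ℝ _ _ 0 (obsL1 ω)
  | 2 => ofBilinear (obsL2 ω hn hω)
  | k + 3 => obsLHigher ω (k + 3) (by omega)

variable {ω} in
lemma obs_higher_mem (k : ℕ) (hk : 3 ≤ k) (d : Fin k → ℤ) (x : Fin k → Observables ω)
    (hx : ∀ i, x i ∈ obsGr ω (d i)) :
    obsLHigher ω k hk x ∈ obsGr ω ((∑ i, d i) + (2 - (k : ℤ))) := by
  by_cases hd : ∀ i, d i = 0
  · refine ⟨fun _ => rfl, fun j hj => ?_⟩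
    have h : iotas k (fun i => (x i).1.1) (ofForm ω) j = 0 := by
      refine iotas_apply_eq_zero (N := n + 1) ?_ _ (ofForm_ne ω)
      intro h
      apply hj
      simp only [hd, Finset.sum_const_zero]
      omega
    simp [obsLHigher, h]
  · push Not at hd
    obtain ⟨i, hi⟩ := hd
    have h : obsLHigher ω k hk x = 0 := by
      have hv : (x i).1.1 = 0 := (hx i).1 hi
      have h := (iotasAlt (E := E) (M := M) k).map_coord_zero (m := fun j => (x j).1.1) i hv
      rw [iotasAlt_apply] at h
      refine Subtype.ext (Prod.ext rfl ?_)
      simp [obsLHigher, h]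
    rw [h]
    exact Submodule.zero_mem _

variable {ω} in
lemma obs_higher_skew (k : ℕ) (hk : 3 ≤ k) (σ : Equiv.Perm (Fin k)) (d : Fin k → ℤ)
    (x : Fin k → Observables ω) (hx : ∀ i, x i ∈ obsGr ω (d i)) :
    obsLHigher ω k hk (fun i => x (σ i)) =
      (Equiv.Perm.sign σ * koszulSign σ d) • obsLHigher ω k hk x := by
  have h := (iotasAlt (E := E) (M := M) k).map_perm (fun j => (x j).1.1) σ
  rw [iotasAlt_apply, iotasAlt_apply] at h
  by_cases hd : ∀ i, d i = 0
  · rw [koszulSign_zero σ d hd, mul_one]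
    refine Subtype.ext (Prod.ext ?_ ?_)
    · rcases Int.units_eq_one_or (Equiv.Perm.sign σ) with hs | hs <;> simp [obsLHigher, hs]
    · have h' : (iotas k fun i => (x (σ i)).1.1) =
          Equiv.Perm.sign σ • iotas k fun i => (x i).1.1 := h
      rcases Int.units_eq_one_or (Equiv.Perm.sign σ) with hs | hs <;>
        simp [obsLHigher, hs, h']
  · push Not at hd
    obtain ⟨i, hi⟩ := hd
    have h0 : iotas k (fun j => (x j).1.1) = 0 := by
      have hv : (x i).1.1 = 0 := (hx i).1 hi
      have h := (iotasAlt (E := E) (M := M) k).map_coord_zero (m := fun j => (x j).1.1) i hv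
      rwa [iotasAlt_apply] at h
    have h0' : iotas k (fun j => (x (σ j)).1.1) = 0 := by
      have h' : (iotas k fun i => (x (σ i)).1.1) =
          Equiv.Perm.sign σ • iotas k fun i => (x i).1.1 := h
      rw [h', h0, smul_zero]
    have e1 : obsLHigher ω k hk x = 0 :=
      Subtype.ext (Prod.ext rfl (by simp [obsLHigher, h0]))
    have e2 : obsLHigher ω k hk (fun i => x (σ i)) = 0 :=
      Subtype.ext (Prod.ext rfl (by simp [obsLHigher, h0']))
    rw [e1, e2, smul_zero]

variable {ω} in
lemma obsL2_swap (hn : 1 ≤ n) (hω : extD E M (n + 1) ω = 0) (x y : Observables ω) :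
    obsL2 ω hn hω x y = - obsL2 ω hn hω y x := by
  refine Subtype.ext (Prod.ext (vbracket_swap _ _) ?_)
  have h := (iotasAlt (E := E) (M := M) 2).map_swap ![x.1.1, y.1.1] (i := 0) (j := 1) (by decide)
  have e : (![x.1.1, y.1.1] ∘ (Equiv.swap 0 1 : Equiv.Perm (Fin 2))) = ![y.1.1, x.1.1] := by
    funext i; fin_cases i <;> simp
  rw [e, iotasAlt_apply, iotasAlt_apply] at h
  have h' := congrArg (fun a : Module.End ℝ (TotalForms E M) => - a (ofForm ω)) h
  simpa [iotas, obsL2] using h'.symm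

variable {ω} in
lemma obsL2_mem (hn : 1 ≤ n) (hω : extD E M (n + 1) ω = 0) (a b : ℤ) (x y : Observables ω)
    (hx : x ∈ obsGr ω a) (hy : y ∈ obsGr ω b) : obsL2 ω hn hω x y ∈ obsGr ω (a + b) := by
  have key : ∀ (a b : ℤ) (x y : Observables ω), x ∈ obsGr ω a → y ∈ obsGr ω b → a ≠ 0 →
      obsL2 ω hn hω x y = 0 := by
    intro a b x y hx hy ha
    have hv : x.1.1 = 0 := hx.1 ha
    refine Subtype.ext (Prod.ext ?_ ?_)
    · have := vbracket_smul_left 0 x.1.1 y.1.1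
      rw [zero_smul, zero_smul] at this
      simp [obsL2, hv, this]
    · simp [obsL2, hv]
  by_cases ha : a = 0
  · by_cases hb : b = 0
    · subst ha hb
      refine ⟨fun h => absurd rfl h, fun k hk => ?_⟩
      have h : ofForm ω (k + 2) = 0 := ofForm_ne ω _ (by omega)
      simp [obsL2, iota, h]
    · rw [obsL2_swap, key b a y x hy hx hb, neg_zero]
      exact Submodule.zero_mem _
  · rw [key a b x y hx hy ha]
    exact Submodule.zero_mem _

variable {ω} in
lemma obsL1_mem (a : ℤ) (x : Observables ω) (hx : x ∈ obsGr ω a) :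
    obsL1 ω x ∈ obsGr ω (a + 1) := by
  refine ⟨fun _ => rfl, fun k hk => ?_⟩
  cases k with
  | zero => simp [obsL1, dTot]
  | succ k =>
    have h : x.1.2 k = 0 := hx.2 k (by push_cast at hk; omega)
    simp [obsL1, dTot, h]

/-- The Lie `n`-algebra of observables `(L(M, ω), {l_k})` of a closed `(n+1)`-form `ω`, `n ≥ 1`. -/
def observables (hn : 1 ≤ n) (hω : extD E M (n + 1) ω = 0) : GradedBrackets (Observables ω) where
  gr := obsGr ω
  isInternal := obs_isInternal ω
  l := obsBracket ω hn hω
  l_zero := rfl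
  l_mem := by
    intro k d x hx
    match k with
    | 0 => exact Submodule.zero_mem _
    | 1 =>
      have h := obsL1_mem (d 0) (x 0) (hx 0)
      have e : (∑ i, d i) + (2 - ((1 : ℕ) : ℤ)) = d 0 + 1 := by simp
      rw [e]
      exact h
    | 2 =>
      have h := obsL2_mem hn hω (d 0) (d 1) (x 0) (x 1) (hx 0) (hx 1)
      have e : (∑ i, d i) + (2 - ((2 : ℕ) : ℤ)) = d 0 + d 1 := by simp [Fin.sum_univ_two]
      rw [e]
      exact h
    | k + 3 => exact obs_higher_mem (k + 3) (by omega) d x hx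
  l_skew := by
    intro k σ d x hx
    match k with
    | 0 => simp [obsBracket]
    | 1 =>
      have hσ : σ = 1 := Subsingleton.elim _ _
      subst hσ
      simp [koszulSign]
    | 2 =>
      by_cases hd : ∀ i, d i = 0
      · rw [koszulSign_zero σ d hd, mul_one]
        exact ofBilinear_skew _ (obsL2_swap hn hω) σ x
      · push Not at hd
        obtain ⟨i, hi⟩ := hd
        have hz : ∀ y : Fin 2 → Observables ω, (∃ j, (y j).1.1 = 0) →
            obsBracket ω hn hω 2 y = 0 := by
          rintro y ⟨j, hj⟩
          have key : ∀ a b : Observables ω, a.1.1 = 0 → obsL2 ω hn hω a b = 0 := by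
            intro a b ha
            have := vbracket_smul_left 0 a.1.1 b.1.1
            rw [zero_smul, zero_smul] at this
            exact Subtype.ext (Prod.ext (by simp [obsL2, ha, this]) (by simp [obsL2, ha]))
          change obsL2 ω hn hω (y 0) (y 1) = 0
          fin_cases j
          · exact key _ _ hj
          · rw [obsL2_swap, key (y 1) (y 0) hj, neg_zero]
        have hv : (x i).1.1 = 0 := (hx i).1 hi
        rw [hz _ ⟨σ.symm i, by simpa using hv⟩, hz _ ⟨i, hv⟩, smul_zero]
    | k + 3 => exact obs_higher_skew (k + 3) (by omega) σ d x hx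

variable (E M) in
/-- An infinitesimal action of a Lie algebra `𝔤` on `M`: a homomorphism of Lie algebras
`ζ : 𝔤 → 𝔛(M)`. -/
structure InfinitesimalAction (𝔤 : Type*) [LieRing 𝔤] [LieAlgebra ℝ 𝔤] where
  toLinearMap : 𝔤 →ₗ[ℝ] VField E M
  map_lie : ∀ X Y : 𝔤, toLinearMap ⁅X, Y⁆ = vbracket (toLinearMap X) (toLinearMap Y)

variable {𝔤 : Type*} [LieRing 𝔤] [LieAlgebra ℝ 𝔤]

/-- A form `τ` is `𝔤`-invariant: `L_{ζ(X)} τ = 0` for all `X ∈ 𝔤`. -/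
def IsInvariant {k : ℕ} (ζ : InfinitesimalAction E M 𝔤) (τ : DiffForm E M k) : Prop :=
  ∀ (X : 𝔤) (p : M) (u : Fin k → TangentSpace 𝓘(ℝ, E) p),
    lieDeriv (ζ.toLinearMap X) τ.1 p u = 0

/-- A homotopy co-moment map for the action `ζ`: an `L_∞`-morphism `F : 𝔤 → L(M, ω)` lifting `ζ`
along `π_𝔛`. -/
structure HomotopyComomentMap (hn : 1 ≤ n) (hω : extD E M (n + 1) ω = 0)
    (ζ : InfinitesimalAction E M 𝔤) extends
    LInftyMorphism (lieBrackets 𝔤) (observables ω hn hω) where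
  lift : ∀ X : 𝔤, obsVec ω (f 1 ![X]) = ζ.toLinearMap X

/-- The action `ζ` is strongly Hamiltonian if it has a homotopy co-moment map. -/
def IsStronglyHamiltonian (hn : 1 ≤ n) (hω : extD E M (n + 1) ω = 0)
    (ζ : InfinitesimalAction E M 𝔤) : Prop :=
  Nonempty (HomotopyComomentMap ω hn hω ζ)

end Observables

end Multisymplectic

end

/-! Since `𝔤` sits in degree zero, a tuple with an argument of nonzero degree contains a zero
vector, and both sides of the morphism equation vanish (`morphism_equation_of_eq_zero`). In degree
zero almost everything collapses. On the left only the binary bracket survives, which leaves a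
signed sum over pairs of arguments (`lieBrackets_source_sum`). On the right a composition into at
least two blocks, one of size at least two, feeds some `f_k` with `k ≥ 2` into a bracket of arity at
least two. Such an `f_k` has no vector field component, and these brackets only see vector fields.
So for `m ≥ 2` there remain `l_1(f_m(x_1, …, x_m))` and `l_m(f_1(x_1), …, f_1(x_m))`
(`target_sum_eq`). For `m = 1` both sides are zero.

The vector components of the remaining equation say that `ζ` is a homomorphism when `m = 2` and are
trivial for `m ≥ 3`. The form components are the multi-contraction Cartan formula `dEnd_iotas`: if
every `L_{v_i} η` vanishes, then `d ι_{v_m} ⋯ ι_{v_1} η = (-1)^m (ι_{v_m} ⋯ ι_{v_1} dη - ∑_{a<b} ±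
ι_{v_m} ⋯ ι_{[v_a, v_b]} η)`, where `v_a` and `v_b` are omitted from the contractions in the sum. It
follows by induction on `m` from `L_v = d ι_v + ι_v d` (`lieDeriv_eq_lieEnd`) and `[L_v, ι_w] =
ι_{[v, w]}` (`lieEnd_mul_iota`), both checked in charts. The signs of the `f_k` are those that turn
this formula into the morphism equation (`comoment_equation`). The values of `f_1` lie in `L_0`
because `d ι_v η = L_v η - ι_v dη = -ι_v ω` (`comoment_mem`). -/

namespace Multisymplectic

/-! ### Unshuffles and the two extreme compositions. -/

section Combinatorics

/-- The permutation with values `a`, `a.succAbove b` at `0`, `1`, increasing on the other indices. -/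
def pairPerm {k : ℕ} (a : Fin (k + 2)) (b : Fin (k + 1)) : Equiv.Perm (Fin (k + 2)) :=
  a.cycleRange.symm * Equiv.Perm.decomposeFin.symm (0, b.cycleRange.symm)

variable {k : ℕ} (a : Fin (k + 2)) (b : Fin (k + 1))

lemma pairPerm_zero : pairPerm a b 0 = a := by
  simp [pairPerm]

lemma pairPerm_one : pairPerm a b 1 = a.succAbove b := by
  have h : (1 : Fin (k + 2)) = Fin.succ 0 := rfl
  rw [pairPerm, Equiv.Perm.mul_apply, h, Equiv.Perm.decomposeFin_symm_apply_succ]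
  simp

lemma pairPerm_succ_succ (t : Fin k) :
    pairPerm a b t.succ.succ = a.succAbove (b.succAbove t) := by
  rw [pairPerm, Equiv.Perm.mul_apply, Equiv.Perm.decomposeFin_symm_apply_succ]
  simp

/-- The two factors are cycles on `a + 1` and `b + 1` indices; extending the second one by a fixed
point does not change its sign. -/
lemma sign_pairPerm : Equiv.Perm.sign (pairPerm a b) = (-1) ^ ((a : ℕ) + b) := by
  rw [pairPerm, Equiv.Perm.sign_mul, Equiv.Perm.decomposeFin.symm_sign]
  simp [Fin.sign_cycleRange, pow_add]

variable {a b}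

/-- Here `b` counts positions in the complement of `a`, so the hypothesis amounts to `a <
a.succAbove b`, the order needed on the first block. -/
lemma isUnshuffle_pairPerm (h : a ≤ b.castSucc) : IsUnshuffle 2 (pairPerm a b) := by
  constructor
  · intro s t hst ht
    have hst' : (s : ℕ) < t := hst
    have ht' : (t : ℕ) = 1 := by omega
    have hs' : (s : ℕ) = 0 := by omega
    obtain rfl : s = 0 := Fin.ext (by simpa using hs')
    obtain rfl : t = 1 := Fin.ext (by simpa using ht')
    rw [pairPerm_zero, pairPerm_one]
    exact (Fin.lt_succAbove_iff_le_castSucc _ _).2 h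
  · intro s t hs hst
    have hr : ∀ r : Fin (k + 2), 2 ≤ (r : ℕ) → ∃ r' : Fin k, r = r'.succ.succ := fun r hr =>
      ⟨⟨r - 2, by omega⟩, by ext; simp; omega⟩
    obtain ⟨s, rfl⟩ := hr s hs
    obtain ⟨t, rfl⟩ := hr t (hs.trans (le_of_lt hst))
    rw [pairPerm_succ_succ, pairPerm_succ_succ]
    exact (Fin.strictMono_succAbove _) ((Fin.strictMono_succAbove _) (by simpa using hst))

/-- An unshuffle is determined by its first two values: the others are listed increasingly, and a
strictly monotone map on a finite linear order is determined by its range. -/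
lemma IsUnshuffle.eq_pairPerm {σ : Equiv.Perm (Fin (k + 2))} (hσ : IsUnshuffle 2 σ) :
    ∃ a b, a ≤ Fin.castSucc b ∧ pairPerm a b = σ := by
  have h01 : σ 0 < σ 1 := hσ.1 0 1 (by simp) (by simp)
  obtain ⟨b, hb⟩ := Fin.exists_succAbove_eq h01.ne'
  have hab : σ 0 ≤ b.castSucc := (Fin.lt_succAbove_iff_le_castSucc _ _).1 (by rwa [hb])
  refine ⟨σ 0, b, hab, ?_⟩
  -- The range of the second block is the complement of the first two values, hence the same for
  -- both permutations.
  have hrange : ∀ τ : Equiv.Perm (Fin (k + 2)),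
      Set.range (fun t : Fin k => τ t.succ.succ) = {τ 0, τ 1}ᶜ := by
    intro τ
    ext y
    obtain ⟨z, rfl⟩ := τ.surjective y
    refine Fin.cases ?_ (fun z => ?_) z
    · simp
    · refine Fin.cases ?_ (fun z => ?_) z
      · simp [Fin.ext_iff]
      · simp [Fin.ext_iff]
  have hmono : ∀ τ : Equiv.Perm (Fin (k + 2)), IsUnshuffle 2 τ →
      StrictMono (fun t : Fin k => τ t.succ.succ) := fun τ hτ s t hst =>
    hτ.2 _ _ (by simp) (by simpa using hst)
  have key := ((hmono _ (isUnshuffle_pairPerm hab)).range_inj (hmono _ hσ)).1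
    (by rw [hrange, hrange, pairPerm_zero, pairPerm_one, hb])
  ext1 z
  refine Fin.cases (pairPerm_zero _ _) (fun z => ?_) z
  refine Fin.cases ((pairPerm_one _ _).trans hb) (fun z => congrFun key z) z

open Classical in
/-- The `(2, k)`-unshuffles are indexed by the pairs of indices. -/
lemma sum_isUnshuffle_two {A : Type*} [AddCommMonoid A] (G : Equiv.Perm (Fin (k + 2)) → A) :
    ∑ σ : Equiv.Perm (Fin (k + 2)) with IsUnshuffle 2 σ, G σ =
      ∑ a : Fin (k + 2), ∑ b : Fin (k + 1), if a ≤ b.castSucc then G (pairPerm a b) else 0 := by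
  rw [← Finset.sum_product', ← Finset.sum_filter]
  symm
  refine Finset.sum_bij (fun p _ => pairPerm p.1 p.2) ?_ ?_ ?_ (fun _ _ => rfl)
  · rintro ⟨a, b⟩ h
    simp only [Finset.mem_filter, Finset.mem_product, Finset.mem_univ, true_and] at h ⊢
    exact isUnshuffle_pairPerm h
  · rintro ⟨a, b⟩ - ⟨a', b'⟩ - h
    have h0 := congrArg (fun τ => τ 0) h
    have h1 := congrArg (fun τ => τ 1) h
    simp only [pairPerm_zero, pairPerm_one] at h0 h1
    subst h0
    rw [Fin.succAbove_right_inj] at h1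
    rw [h1]
  · intro σ hσ
    simp only [Finset.mem_filter, Finset.mem_univ, true_and] at hσ
    obtain ⟨a, b, hab, h⟩ := hσ.eq_pairPerm
    exact ⟨(a, b), by simpa using hab, h⟩

lemma perm_eq_one_of_strictMono {n : ℕ} {σ : Equiv.Perm (Fin n)} (h : StrictMono σ) : σ = 1 :=
  Equiv.ext fun x => congrFun ((h.range_inj strictMono_id).1 (by simp)) x

lemma val_embedding_single {n : ℕ} (h : 0 < n) (i : Fin (Composition.single n h).length)
    (t : Fin ((Composition.single n h).blocksFun i)) :
    ((Composition.single n h).embedding i t : ℕ) = t := by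
  have hi : (i : ℕ) < 1 := i.2
  have hi' : (i : ℕ) = 0 := by omega
  rw [Composition.coe_embedding, hi', Composition.sizeUpTo_zero, zero_add]

lemma val_embedding_ones {n : ℕ} (i : Fin (Composition.ones n).length)
    (t : Fin ((Composition.ones n).blocksFun i)) :
    ((Composition.ones n).embedding i t : ℕ) = i := by
  have ht : (t : ℕ) < 1 := t.2.trans_eq (Composition.ones_blocksFun n i)
  have hi : (i : ℕ) < n := i.2.trans_eq (Composition.ones_length n)
  rw [Composition.coe_embedding, Composition.ones_sizeUpTo]
  omega

/-- With a single block, monotonicity on blocks is monotonicity everywhere. -/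
lemma isBlockUnshuffle_single_iff {n : ℕ} (h0 : 0 < n) (σ : Equiv.Perm (Fin n)) :
    IsBlockUnshuffle (Composition.single n h0) σ ↔ σ = 1 := by
  constructor
  · rintro ⟨h1, -⟩
    exact perm_eq_one_of_strictMono fun a b hab => by
      have h := h1 ⟨0, by simp⟩ (a := a) (b := b) hab
      have e : ∀ t : Fin n, (Composition.single n h0).embedding ⟨0, by simp⟩ t = t := fun t =>
        Fin.ext (val_embedding_single h0 _ _)
      exact (congrArg σ (e a)).symm.trans_lt (h.trans_eq (congrArg σ (e b)))
  · rintro rfl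
    refine ⟨fun i => (Composition.embedding _ i).strictMono, fun i j hij => ?_⟩
    have hj : (j : ℕ) < 1 := j.2
    omega

/-- With all blocks of size one, monotonicity on blocks is empty; the ordering condition on first
elements of consecutive blocks of equal size forces the identity. Thus `l_m(f_1, …, f_1)` occurs
only once. -/
lemma isBlockUnshuffle_ones_iff {n : ℕ} (σ : Equiv.Perm (Fin n)) :
    IsBlockUnshuffle (Composition.ones n) σ ↔ σ = 1 := by
  constructor
  · rintro ⟨-, h2⟩
    cases n with
    | zero => exact Subsingleton.elim _ _
    | succ n =>
      refine perm_eq_one_of_strictMono (Fin.strictMono_iff_lt_succ.2 fun i => ?_)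
      have h := h2 ⟨i, by simp⟩ ⟨i + 1, by simp⟩ rfl (by simp)
      have e1 := Fin.ext (b := i.castSucc) (val_embedding_ones (n := n + 1) ⟨i, by simp⟩
        ⟨0, by simp⟩)
      have e2 := Fin.ext (b := i.succ) (val_embedding_ones (n := n + 1) ⟨i + 1, by simp⟩
        ⟨0, by simp⟩)
      exact (congrArg σ e1).symm.trans_lt (h.trans_eq (congrArg σ e2))
  · rintro rfl
    refine ⟨fun i => (Composition.embedding _ i).strictMono, fun i j hij _ => ?_⟩
    simp only [Equiv.Perm.coe_one, id, Fin.lt_def, val_embedding_ones]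
    omega

lemma morphismExponent_single {n : ℕ} (h : 0 < n) (σ : Equiv.Perm (Fin n)) (d : Fin n → ℤ) :
    morphismExponent (Composition.single n h) σ d = 0 := by
  simp [morphismExponent, Composition.single_length]

/-- The first two summands of the exponent are both equal to `n(n-1)/2`, and the third vanishes in
degree zero, so the total is even. -/
lemma morphismExponent_ones {n : ℕ} (σ : Equiv.Perm (Fin n)) (d : Fin n → ℤ)
    (hd : ∀ i, d i = 0) : Even (morphismExponent (Composition.ones n) σ d) := by
  have h1 : ∑ i : Fin (Composition.ones n).length,
      ((Composition.ones n).blocksFun i : ℤ) * (((Composition.ones n).length : ℤ) - (i + 1)) =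
      ((n * (n - 1) / 2 : ℕ) : ℤ) := by
    rw [← Finset.sum_range_id_mul_two n, Nat.mul_div_cancel _ two_pos, ← Finset.sum_range_reflect,
      Finset.sum_range, Nat.cast_sum]
    refine Fintype.sum_equiv (finCongr (Composition.ones_length n)) _ _ fun i => ?_
    have := i.2
    simp only [Composition.ones_length] at this
    simp
    omega
  have h2 : ∑ i : Fin (Composition.ones n).length, (((Composition.ones n).blocksFun i : ℤ) - 1) *
      ∑ t : Fin n, (if (t : ℕ) < (Composition.ones n).sizeUpTo i then d (σ t) else 0) = 0 := by
    simp [hd]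
  rw [morphismExponent, h1, h2, add_zero, Composition.ones_length]
  exact Even.add_self _

end Combinatorics

/-! ### The equations of an `L_∞`-morphism out of a Lie algebra. -/

section LInfinity

variable {V W : Type*} [AddCommGroup V] [Module ℝ V] [AddCommGroup W] [Module ℝ W]

/-- Arities such as `c.length` or `c.blocksFun i` equal the expected numbers only propositionally;
this transports arguments along such an equality. -/
lemma multilinear_family_congr (f : (k : ℕ) → MultilinearMap ℝ (fun _ : Fin k => V) W) {k k' : ℕ}
    (h : k = k') {x : Fin k → V} {y : Fin k' → V} (hxy : ∀ t, x t = y (Fin.cast h t)) :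
    f k x = f k' y := by
  subst h
  exact congrArg (f k) (funext hxy)

variable {𝔤 : Type*} [LieRing 𝔤] [LieAlgebra ℝ 𝔤]

lemma lieBrackets_l_of_ne {k : ℕ} (hk : k ≠ 2) : (lieBrackets 𝔤).l k = 0 := by
  match k, hk with
  | 0, _ => rfl
  | 1, _ => rfl
  | k + 3, _ => rfl

open Classical in
/-- The left hand side of the equations of an `L_∞`-morphism defined on a Lie algebra. -/
lemma lieBrackets_source_sum (f : (k : ℕ) → MultilinearMap ℝ (fun _ : Fin k => 𝔤) W) {k : ℕ}
    (x : Fin (k + 2) → 𝔤) (d : Fin (k + 2) → ℤ) (hd : ∀ i, d i = 0) :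
    (∑ i : Fin (k + 2), ∑ σ : Equiv.Perm (Fin (k + 2)) with IsUnshuffle (i + 1) σ,
      ((-1 : ℤˣ) ^ (((i : ℕ) + 1) * (k + 2 - i + 1)) * Equiv.Perm.sign σ * koszulSign σ d) •
        f (k + 2 - i) (fun t : Fin (k + 2 - i) =>
          if (t : ℕ) = 0 then
            (lieBrackets 𝔤).l (i + 1) (fun s : Fin (i + 1) => x (σ ⟨s, by omega⟩))
          else x (σ ⟨i + t, by omega⟩))) =
    ∑ a : Fin (k + 2), ∑ b : Fin (k + 1), if a ≤ b.castSucc then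
      ((-1 : ℤˣ) ^ ((a : ℕ) + b)) • f (k + 1) (Matrix.vecCons ⁅x a, x (a.succAbove b)⁆
        (fun t => x (a.succAbove (b.succAbove t)))) else 0 := by
  -- The index is one less than the arity of the inner bracket, so index `1` is the Lie bracket.
  rw [Finset.sum_eq_single ⟨1, by omega⟩]
  · refine (sum_isUnshuffle_two _).trans ?_
    refine Finset.sum_congr rfl fun a _ => Finset.sum_congr rfl fun b _ => ?_
    split_ifs with hab
    swap; · rfl
    congr 1
    -- The factor `(-1)^{i(j+1)}` is trivial because `i = 2` is even.
    · rw [koszulSign_zero _ _ hd, sign_pairPerm, pow_mul]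
      simp
    · refine multilinear_family_congr f rfl fun t => ?_
      obtain ⟨t, ht⟩ := t
      cases t with
      | zero =>
        simp only [if_true]
        change ⁅x (pairPerm a b 0), x (pairPerm a b 1)⁆ = _
        rw [pairPerm_zero, pairPerm_one]
        rfl
      | succ t =>
        have ht' : t < k := by simp at ht; omega
        have e : (⟨1 + (t + 1), by omega⟩ : Fin (k + 2)) = (⟨t, ht'⟩ : Fin k).succ.succ := by
          ext; simp; omega
        simp only [Nat.add_eq_zero_iff, one_ne_zero, and_false, if_false]
        rw [e, pairPerm_succ_succ]
        rfl
  · intro i _ hi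
    refine Finset.sum_eq_zero fun σ _ => ?_
    have hi' : (i : ℕ) + 1 ≠ 2 := fun h => hi (by ext; simp at h; simp; omega)
    rw [MultilinearMap.map_coord_zero _ ⟨0, by omega⟩, smul_zero]
    simp [lieBrackets_l_of_ne hi']
  · simp

open Classical in
/-- In the equations of an `L_∞`-morphism all the terms vanish when one of the arguments is zero. -/
lemma morphism_equation_of_eq_zero (A : GradedBrackets V) (B : GradedBrackets W)
    (f : (k : ℕ) → MultilinearMap ℝ (fun _ : Fin k => V) W) {n : ℕ} (d : Fin n → ℤ) (x : Fin n → V)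
    (i₀ : Fin n) (h₀ : x i₀ = 0) :
    (∑ i : Fin n, ∑ σ : Equiv.Perm (Fin n) with IsUnshuffle (i + 1) σ,
      ((-1 : ℤˣ) ^ (((i : ℕ) + 1) * (n - i + 1)) * Equiv.Perm.sign σ * koszulSign σ d) •
        f (n - i) (fun t : Fin (n - i) =>
          if (t : ℕ) = 0 then
            A.l (i + 1) (fun s : Fin (i + 1) => x (σ ⟨s, by omega⟩))
          else x (σ ⟨i + t, by omega⟩))) =
    ∑ c : Composition n with Monotone c.blocksFun,
      ∑ σ : Equiv.Perm (Fin n) with IsBlockUnshuffle c σ,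
        ((morphismExponent c σ d).negOnePow * Equiv.Perm.sign σ * koszulSign σ d) •
          B.l c.length (fun i => f (c.blocksFun i) (fun t => x (σ (c.embedding i t)))) := by
  trans (0 : W)
  · refine Finset.sum_eq_zero fun i _ => Finset.sum_eq_zero fun σ _ => ?_
    obtain ⟨t, ht⟩ := σ.surjective i₀
    by_cases hti : (t : ℕ) < i + 1
    · rw [MultilinearMap.map_coord_zero _ ⟨0, by omega⟩, smul_zero]
      rw [if_pos rfl, MultilinearMap.map_coord_zero _ ⟨t, hti⟩]
      simp [ht, h₀]
    · rw [MultilinearMap.map_coord_zero _ ⟨t - i, by omega⟩, smul_zero]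
      rw [if_neg (by simp; omega)]
      have e : (⟨i + ((⟨t - i, by omega⟩ : Fin (n - i)) : ℕ), by simp; omega⟩ : Fin n) = t := by
        ext; simp; omega
      rw [e, ht, h₀]
  · symm
    refine Finset.sum_eq_zero fun c _ => Finset.sum_eq_zero fun σ _ => ?_
    obtain ⟨t, ht⟩ := σ.surjective i₀
    rw [MultilinearMap.map_coord_zero _ (c.index t), smul_zero]
    refine MultilinearMap.map_coord_zero _ (c.invEmbedding t) ?_
    rw [c.embedding_comp_inv, ht, h₀]

open Classical in
/-- The right hand side of the equations of an `L_∞`-morphism when a bracket of arity at least two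
vanishes as soon as one of its arguments is a value of a component of arity at least two. -/
lemma target_sum_eq (B : GradedBrackets W) (f : (k : ℕ) → MultilinearMap ℝ (fun _ : Fin k => V) W)
    (hB : ∀ (k : ℕ) (y : Fin k → W), 2 ≤ k → (∃ i m, 2 ≤ m ∧ ∃ x, y i = f m x) → B.l k y = 0)
    {n : ℕ} (hn : 2 ≤ n) (d : Fin n → ℤ) (x : Fin n → V) (hd : ∀ i, d i = 0) :
    ∑ c : Composition n with Monotone c.blocksFun,
      ∑ σ : Equiv.Perm (Fin n) with IsBlockUnshuffle c σ,
        ((morphismExponent c σ d).negOnePow * Equiv.Perm.sign σ * koszulSign σ d) •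
          B.l c.length (fun i => f (c.blocksFun i) (fun t => x (σ (c.embedding i t)))) =
    B.l 1 ![f n x] + B.l n (fun i => f 1 ![x i]) := by
  have hn0 : 0 < n := by omega
  -- The two surviving compositions have lengths `1` and `n`; they are distinct because `n ≥ 2`.
  have hne : Composition.single n hn0 ≠ Composition.ones n := by
    intro h
    have := congrArg Composition.length h
    simp at this
    omega
  have hsub : ({Composition.single n hn0, Composition.ones n} : Finset (Composition n)) ⊆
      Finset.univ.filter fun c => Monotone c.blocksFun := by
    intro c hc
    simp only [Finset.mem_insert, Finset.mem_singleton] at hc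
    simp only [Finset.mem_filter, Finset.mem_univ, true_and]
    rcases hc with rfl | rfl
    · intro i j _
      rw [Composition.single_blocksFun, Composition.single_blocksFun]
    · intro i j _
      rw [Composition.ones_blocksFun, Composition.ones_blocksFun]
  rw [← Finset.sum_subset hsub, Finset.sum_pair hne]
  · congr 1
    · simp only [isBlockUnshuffle_single_iff, Finset.filter_eq', Finset.mem_univ, if_true,
        Finset.sum_singleton, morphismExponent_single hn0 _ d, koszulSign_zero _ d hd,
        Int.negOnePow_zero, Equiv.Perm.sign_one, one_smul, mul_one]
      refine multilinear_family_congr B.l (Composition.single_length hn0) fun i => ?_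
      refine (multilinear_family_congr f (Composition.single_blocksFun hn0 i) (y := x)
        fun t => ?_).trans ?_
      · exact congrArg x (Fin.ext (val_embedding_single hn0 i t))
      · simp
    · simp only [isBlockUnshuffle_ones_iff, Finset.filter_eq', Finset.mem_univ, if_true,
        Finset.sum_singleton, Int.negOnePow_even _ (morphismExponent_ones _ d hd),
        koszulSign_zero _ d hd, Equiv.Perm.sign_one, one_smul, mul_one]
      refine multilinear_family_congr B.l (Composition.ones_length n) fun i => ?_
      refine multilinear_family_congr f (Composition.ones_blocksFun n i) fun t => ?_
      have e : Fin.cast (Composition.ones_blocksFun n i) t = 0 := Subsingleton.elim _ _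
      rw [e]
      exact congrArg x (Fin.ext (val_embedding_ones i t))
  · intro c _ hc
    simp only [Finset.mem_insert, Finset.mem_singleton, not_or] at hc
    refine Finset.sum_eq_zero fun σ _ => ?_
    have h1 : c.length ≠ 1 := fun h => hc.1 ((Composition.eq_single_iff_length hn0).2 h)
    have h2 : 0 < c.length := c.length_pos_of_pos hn0
    -- Any other composition has at least two blocks and some block of size `m > 1`, so `hB` kills
    -- its term.
    obtain ⟨m, hm, hm1⟩ := Composition.ne_ones_iff.1 hc.2
    obtain ⟨i, hi⟩ := List.get_of_mem hm
    rw [hB _ _ (by omega), smul_zero]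
    exact ⟨i, c.blocksFun i, by rw [← hi] at hm1; exact hm1, _, rfl⟩

end LInfinity

end Multisymplectic

noncomputable section

namespace Multisymplectic

/-! ### Cartan calculus, from charts to forms of all degrees. -/

section Forms

variable {E : Type*} [NormedAddCommGroup E] [NormedSpace ℝ E]
  {M : Type*} [TopologicalSpace M] [ChartedSpace E M]

/-- Cartan's formula in degree zero. -/
lemma lieDerivVec_eq_zero_form {V : E → E} {η : E → E [⋀^Fin 0]→L[ℝ] ℝ} {x : E} (u : Fin 0 → E) :
    lieDerivVec V η x u = extDeriv η x (Matrix.vecCons (V x) u) := by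
  rw [extDeriv, ContinuousAlternatingMap.alternatizeUncurryFin_apply]
  have h : Fin.removeNth 0 (Matrix.vecCons (V x) u) = u := Subsingleton.elim _ _
  simp [lieDerivVec, h]

/-- `L_V ι_W η = ι_W L_V η + ι_{[V, W]} η`. -/
lemma lieDerivVec_contract {k : ℕ} {V W : E → E} {η : E → E [⋀^Fin (k + 1)]→L[ℝ] ℝ} {x : E}
    (hW : DifferentiableAt ℝ W x) (hη : DifferentiableAt ℝ η x) (u : Fin k → E) :
    lieDerivVec V (fun y => (η y).curryLeft (W y)) x u =
      lieDerivVec V η x (Matrix.vecCons (W x) u) +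
        η x (Matrix.vecCons (VectorField.lieBracket ℝ V W x) u) := by
  have hc := hasFDerivAt_curryLeft hW hη
  simp only [lieDerivVec, hc.fderiv]
  rw [Fin.sum_univ_succ]
  have h3 : ∀ a : E, Function.update (Matrix.vecCons (W x) u) 0 a = Matrix.vecCons a u := by
    intro a; ext j; refine Fin.cases ?_ (fun j => ?_) j <;> simp
  have h4 : ∀ (a : E) (i : Fin k), Function.update (Matrix.vecCons (W x) u) i.succ a =
      Matrix.vecCons (W x) (Function.update u i a) := by
    intro a i; ext j
    refine Fin.cases ?_ (fun j => ?_) j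
    · simp [Function.update, (Fin.succ_ne_zero i).symm]
    · simp [Function.update]
  have h5 : η x (Matrix.vecCons (VectorField.lieBracket ℝ V W x) u) =
      η x (Matrix.vecCons (fderiv ℝ W x (V x)) u) - η x (Matrix.vecCons (fderiv ℝ V x (W x)) u) := by
    have := (η x).curryLeft.map_sub (fderiv ℝ W x (V x)) (fderiv ℝ V x (W x))
    exact congrArg (fun a => a u) this
  simp only [h3, h4, h5, Matrix.cons_val_zero, Matrix.cons_val_succ, _root_.add_apply,
    ContinuousAlternatingMap.add_apply, ContinuousLinearMap.flip_apply,
    ContinuousLinearMap.comp_apply, ContinuousAlternatingMap.curryLeft_apply_apply]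
  have h6 : ((ContinuousAlternatingMap.curryLeftLI (𝕜 := ℝ) (E := E) (F := ℝ)
        (n := k)).toContinuousLinearMap (fderiv ℝ η x (V x))) (W x) u =
      fderiv ℝ η x (V x) (Matrix.vecCons (W x) u) := rfl
  rw [h6]
  ring

lemma differentiableAt_chartRep {k : ℕ} (τ : DiffForm E M k) (p : M) :
    DifferentiableAt ℝ (chartRep p τ.1) (extChartAt 𝓘(ℝ, E) p p) :=
  ((τ.2 p).contDiffAt (extChartAt_target_mem_nhds p)).differentiableAt (by simp)

variable [IsManifold 𝓘(ℝ, E) smooth M]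

/-- The derivatives of the chart and of its inverse cancel, and `vecRep` is by definition a pullback
along the inverse chart. -/
lemma dChart_apply_self (v : VField E M) (p : M) :
    dChart p p (v p) = vecRep p v (extChartAt 𝓘(ℝ, E) p p) := by
  have hx : extChartAt 𝓘(ℝ, E) p p ∈ (extChartAt 𝓘(ℝ, E) p).target := mem_extChartAt_target p
  -- The point `q` stands for the image of `p` under the chart followed by its inverse; it equals
  -- `p` only propositionally, so the tangent space has to be generalised before substituting.
  have key : ∀ q (hq : q = p) (A : E →L[ℝ] TangentSpace 𝓘(ℝ, E) q) (e : E), A e = v q →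
      (∀ u : E, dChart p q (A u) = u) → dChart p p (v p) = e := by
    rintro q rfl A e hA h
    rw [← hA, h]
  exact key _ (extChartAt_to_inv p) _ _ (dChartSymm_vecRep hx v) (dChart_comp_dChartSymm hx)

variable [FiniteDimensional ℝ E]

lemma differentiableAt_vecRep (v : VField E M) (p : M) :
    DifferentiableAt ℝ (vecRep p v) (extChartAt 𝓘(ℝ, E) p p) :=
  ((contDiffOn_vecRep p v).contDiffAt (extChartAt_target_mem_nhds p)).differentiableAt (by simp)

lemma chartRep_contract_eventuallyEq {k : ℕ} (v : VField E M) (τ : DiffForm E M (k + 1)) (p : M) :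
    chartRep p (contract k v τ).1 =ᶠ[𝓝 (extChartAt 𝓘(ℝ, E) p p)]
      fun y => (chartRep p τ.1 y).curryLeft (vecRep p v y) := by
  filter_upwards [extChartAt_target_mem_nhds (I := 𝓘(ℝ, E)) p] with y hy
  exact chartRep_contractField hy v τ.1

/-- The bracket on `M` is defined by pulling both fields back to the chart, bracketing there and
transporting the result back; the derivative of the chart undoes the last step. -/
lemma dChart_vbracket (v w : VField E M) (p : M) :
    dChart p p (vbracket v w p) =
      VectorField.lieBracket ℝ (vecRep p v) (vecRep p w) (extChartAt 𝓘(ℝ, E) p p) := by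
  have h1 := (isInvertible_mfderiv_extChartAt (I := 𝓘(ℝ, E))
    (mem_extChartAt_source (I := 𝓘(ℝ, E)) p)).self_apply_inverse
    (VectorField.lieBracketWithin ℝ (E := E) (vecRep p v) (vecRep p w)
      ((extChartAt 𝓘(ℝ, E) p).symm ⁻¹' Set.univ ∩ Set.range 𝓘(ℝ, E)) (extChartAt 𝓘(ℝ, E) p p))
  have h2 : ((extChartAt 𝓘(ℝ, E) p).symm ⁻¹' Set.univ ∩ Set.range 𝓘(ℝ, E)) = Set.univ := by
    simp
  have h3 := congrArg (fun s => VectorField.lieBracketWithin ℝ (vecRep p v) (vecRep p w) s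
    (extChartAt 𝓘(ℝ, E) p p)) h2
  simp only [VectorField.lieBracketWithin_univ] at h3
  exact h1.trans h3

/-- `L_v ι_w τ = ι_w L_v τ + ι_{[v, w]} τ`, pointwise. -/
lemma lieDeriv_contract {k : ℕ} (v w : VField E M) (τ : DiffForm E M (k + 1)) (p : M)
    (u : Fin k → TangentSpace 𝓘(ℝ, E) p) :
    lieDeriv v (contract k w τ).1 p u =
      lieDeriv v τ.1 p (Matrix.vecCons (w p) u) + (contract k (vbracket v w) τ).1 p u := by
  have h := lieDerivVec_contract (V := vecRep p v) (differentiableAt_vecRep w p)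
    (differentiableAt_chartRep τ p) (fun i => dChart p p (u i))
  have hc := chartRep_contract_eventuallyEq w τ p
  -- The Lie derivative at a point depends only on the germ of the coordinate expression.
  have e1 : lieDeriv v (contract k w τ).1 p u =
      lieDerivVec (vecRep p v) (fun y => (chartRep p τ.1 y).curryLeft (vecRep p w y))
        (extChartAt 𝓘(ℝ, E) p p) (fun i => dChart p p (u i)) := by
    rw [lieDeriv, lieDerivVec, lieDerivVec, hc.fderiv_eq, hc.self_of_nhds]
  have e2 : ∀ v' : VField E M, (fun i => dChart p p
      ((Matrix.vecCons (v' p) u : Fin (k + 1) → TangentSpace 𝓘(ℝ, E) p) i) : Fin (k + 1) → E) =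
      Matrix.vecCons (dChart p p (v' p) : E) (fun i => dChart p p (u i)) := by
    intro v'
    funext i
    refine Fin.cases rfl (fun i => rfl) i
  have e3 : (contract k (vbracket v w) τ).1 p u =
      chartRep p τ.1 (extChartAt 𝓘(ℝ, E) p p)
        (Matrix.vecCons (dChart p p (vbracket v w p) : E) (fun i => dChart p p (u i))) := by
    rw [← e2]
    exact eq_chartRep p τ.1 (Matrix.vecCons (vbracket v w p) u)
  rw [e1, h, e3, dChart_vbracket, lieDeriv, e2, dChart_apply_self]

/-! ### Operators on the product of all spaces of forms. -/

variable (E M) in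
/-- The exterior derivative as an endomorphism of the product of all the spaces of forms. -/
def dEnd : Module.End ℝ (TotalForms E M) where
  toFun := dTot E M
  map_add' a b := funext fun k => by cases k <;> simp [dTot]
  map_smul' c a := funext fun k => by cases k <;> simp [dTot]

/-- The Lie derivative `d ι_v + ι_v d` on forms of all degrees. -/
def lieEnd (v : VField E M) : Module.End ℝ (TotalForms E M) := dEnd E M * iota v + iota v * dEnd E M

lemma extD_apply {k : ℕ} (τ : DiffForm E M k) (p : M)
    (u : Fin (k + 1) → TangentSpace 𝓘(ℝ, E) p) :
    (extD E M k τ).1 p u =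
      extDeriv (chartRep p τ.1) (extChartAt 𝓘(ℝ, E) p p) (fun i => dChart p p (u i)) := rfl

/-- Cartan's formula. -/
lemma lieDeriv_eq_lieEnd (v : VField E M) (α : TotalForms E M) (k : ℕ) (p : M)
    (u : Fin k → TangentSpace 𝓘(ℝ, E) p) : lieDeriv v (α k).1 p u = (lieEnd v α k).1 p u := by
  have e2 : ∀ {k : ℕ} (u : Fin k → TangentSpace 𝓘(ℝ, E) p), (fun i => dChart p p
      ((Matrix.vecCons (v p) u : Fin (k + 1) → TangentSpace 𝓘(ℝ, E) p) i) : Fin (k + 1) → E) =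
      Matrix.vecCons (vecRep p v (extChartAt 𝓘(ℝ, E) p p)) (fun i => dChart p p (u i)) := by
    intro k u
    rw [← dChart_apply_self]
    funext i
    refine Fin.cases rfl (fun i => rfl) i
  have e3 : ∀ {k : ℕ} (τ : DiffForm E M k) (u : Fin k → TangentSpace 𝓘(ℝ, E) p),
      (contract k v (extD E M k τ)).1 p u = extDeriv (chartRep p τ.1) (extChartAt 𝓘(ℝ, E) p p)
        (Matrix.vecCons (vecRep p v (extChartAt 𝓘(ℝ, E) p p)) (fun i => dChart p p (u i))) := by
    intro k τ u
    rw [← e2]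
    rfl
  cases k with
  | zero =>
    have h : lieEnd v α 0 = contract 0 v (extD E M 0 (α 0)) := by
      -- On functions the summand `d ι_v` has zero component, by the conventions for `dTot` and
      -- `iota` in degree zero.
      change (0 : DiffForm E M 0) + contract 0 v (extD E M 0 (α 0)) = _
      rw [zero_add]
    rw [h, e3, lieDeriv, lieDerivVec_eq_zero_form]
  | succ k =>
    have h : (lieEnd v α (k + 1)).1 p u = (extD E M k (contract k v (α (k + 1)))).1 p u +
        (contract (k + 1) v (extD E M (k + 1) (α (k + 1)))).1 p u := rfl
    rw [h, e3, lieDeriv, lieDerivVec_eq (differentiableAt_vecRep v p)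
      (differentiableAt_chartRep (α (k + 1)) p), extD_apply,
      (chartRep_contract_eventuallyEq v (α (k + 1)) p).extDeriv_eq]

/-- `[L_v, ι_w] = ι_{[v, w]}`. -/
lemma lieEnd_mul_iota (v w : VField E M) :
    lieEnd v * iota w = iota w * lieEnd v + iota (vbracket v w) := by
  refine LinearMap.ext fun α => funext fun k => Subtype.ext (funext fun p =>
    ContinuousAlternatingMap.ext fun u => ?_)
  have h := lieDeriv_contract v w (α (k + 1)) p u
  rw [lieDeriv_eq_lieEnd v α (k + 1)] at h
  exact (lieDeriv_eq_lieEnd v (iota w α) k p u).symm.trans h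

/-- Turns pointwise invariance into an equation between operators, the form in which it enters the
induction of `dEnd_iotas`. -/
lemma lieEnd_ofForm_eq_zero {k : ℕ} (v : VField E M) (τ : DiffForm E M k)
    (h : ∀ p u, lieDeriv v τ.1 p u = 0) : lieEnd v (ofForm τ) = 0 := by
  refine funext fun j => Subtype.ext (funext fun p => ContinuousAlternatingMap.ext fun u => ?_)
  rw [← lieDeriv_eq_lieEnd]
  by_cases hj : j = k
  · subst hj
    rw [ofForm, Pi.single_eq_same, h]
    rfl
  · rw [ofForm_ne τ j hj]
    have h0 : lieDeriv v (0 : DiffForm E M j).1 p u = (lieEnd v 0 j).1 p u :=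
      lieDeriv_eq_lieEnd v 0 j p u
    rw [h0, map_zero]

/-- Polarisation of `ι_{v+w}² = 0`. -/
lemma iota_iota (v w : VField E M) (α : TotalForms E M) :
    iota v (iota w α) = -iota w (iota v α) := by
  have h := iota_sq (v + w)
  rw [map_add, add_mul, mul_add, mul_add, iota_sq, iota_sq, zero_add, add_zero] at h
  exact eq_neg_of_add_eq_zero_left (LinearMap.congr_fun h α)

/-- The definition of `iotas` splits off the innermost contraction; the induction for the
multi-contraction formula needs the outermost one. -/
lemma iotas_succ_last (k : ℕ) (v : Fin (k + 1) → VField E M) :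
    iotas (k + 1) v = iota (v (Fin.last k)) * iotas k (fun i => v i.castSucc) := by
  induction k with
  | zero => simp [iotas]
  | succ k ih =>
    rw [iotas, ih, iotas, mul_assoc]
    rfl

lemma iotas_cons (k : ℕ) (w : VField E M) (v : Fin k → VField E M) :
    iotas (k + 1) (Matrix.vecCons w v) = iotas k v * iota w := rfl

/-- Commuting `L_w` past the contractions replaces each `v_j` in turn by `[w, v_j]`; making that
contraction the innermost one moves it past `j` others, whence `(-1)^j`. -/
lemma lieEnd_mul_iotas (w : VField E M) (k : ℕ) (v : Fin (k + 1) → VField E M) :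
    lieEnd w * iotas (k + 1) v = iotas (k + 1) v * lieEnd w +
      ∑ j : Fin (k + 1), (-1 : ℝ) ^ (j : ℕ) •
        iotas (k + 1) (Matrix.vecCons (vbracket w (v j)) (fun t => v (j.succAbove t))) := by
  induction k with
  | zero => simp [iotas, lieEnd_mul_iota]
  | succ k ih =>
    rw [iotas, ← mul_assoc, ih, add_mul, mul_assoc, lieEnd_mul_iota, mul_add, ← mul_assoc, add_assoc,
      Fin.sum_univ_succ (n := k + 1), Finset.sum_mul]
    congr 2
    · simp [iotas]
    · refine Finset.sum_congr rfl fun j _ => ?_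
      have e : Matrix.vecCons (vbracket w (v j.succ)) (fun t => v (j.succ.succAbove t)) =
          Matrix.vecCons (vbracket w (v j.succ)) (Matrix.vecCons (v 0)
            (fun t => v (j.succAbove t).succ)) := by
        refine congrArg (Matrix.vecCons _) (funext fun t => ?_)
        refine Fin.cases (by simp) (fun t => by simp) t
      refine LinearMap.ext fun α => ?_
      rw [e, iotas_cons, iotas_cons, iotas_cons, Fin.val_succ, pow_succ, mul_neg_one]
      simp only [Module.End.mul_apply, LinearMap.smul_apply]
      -- The induction has already moved the bracket past the other contractions; exchanging it with
      -- `v 0` gives the last sign.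
      rw [iota_iota (v 0), map_neg, smul_neg, neg_smul, neg_neg]

/-- The sum `∑_{a < b} ± ι(v_k) ⋯ ι([v_a, v_b])`, over all pairs of vector fields of a family. -/
def bracketContraction {k : ℕ} (v : Fin (k + 2) → VField E M) : Module.End ℝ (TotalForms E M) :=
  ∑ a : Fin (k + 2), ∑ b : Fin (k + 1), if a ≤ b.castSucc then
    (-1 : ℝ) ^ ((a : ℕ) + b) • iotas (k + 1) (Matrix.vecCons (vbracket (v a) (v (a.succAbove b)))
      (fun t => v (a.succAbove (b.succAbove t)))) else 0

lemma succAbove_castSucc_last {k : ℕ} (a : Fin (k + 1)) :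
    a.castSucc.succAbove (Fin.last k) = Fin.last (k + 1) := by
  rw [Fin.succAbove_of_le_castSucc _ _ (by simp [Fin.le_last]), Fin.succ_last]

/-- Separates the pairs avoiding the last index, where its contraction is outermost and factors out,
from the pairs `(a, last)`. There the sign `(-1)^{a+k+1}` becomes `(-1)^{a+k}` on rewriting `[v_a,
v_last]` as `-[v_last, v_a]`. -/
lemma bracketContraction_succ {k : ℕ} (v : Fin (k + 3) → VField E M) :
    bracketContraction v = iota (v (Fin.last _)) * bracketContraction (fun i => v i.castSucc) +
      (-1 : ℝ) ^ k • ∑ j : Fin (k + 2), (-1 : ℝ) ^ (j : ℕ) • iotas (k + 2)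
        (Matrix.vecCons (vbracket (v (Fin.last _)) (v j.castSucc))
          (fun t => v (j.succAbove t).castSucc)) := by
  -- The last index is never the smaller member of a pair.
  have h0 : ∑ b : Fin (k + 2), (if Fin.last (k + 2) ≤ b.castSucc then
      (-1 : ℝ) ^ ((Fin.last (k + 2) : ℕ) + b) • iotas (k + 2) (Matrix.vecCons
        (vbracket (v (Fin.last (k + 2))) (v ((Fin.last (k + 2)).succAbove b)))
        (fun t => v ((Fin.last (k + 2)).succAbove (b.succAbove t)))) else 0) = 0 :=
    Finset.sum_eq_zero fun b _ => if_neg (by simp [Fin.le_def])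
  rw [bracketContraction, Fin.sum_univ_castSucc (n := k + 2), h0, add_zero, bracketContraction,
    Finset.mul_sum, Finset.smul_sum, ← Finset.sum_add_distrib]
  refine Finset.sum_congr rfl fun a _ => ?_
  rw [Fin.sum_univ_castSucc, Finset.mul_sum]
  congr 1
  · refine Finset.sum_congr rfl fun b _ => ?_
    simp only [Fin.castSucc_le_castSucc_iff, Fin.val_castSucc]
    split_ifs with hab
    swap; · simp
    rw [mul_smul_comm, iotas_succ_last (k + 1), iotas_cons]
    have h1 : ∀ t : Fin k, a.castSucc.succAbove (b.castSucc.succAbove t.castSucc) =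
        (a.succAbove (b.succAbove t)).castSucc := by
      intro t
      rw [Fin.castSucc_succAbove_castSucc, Fin.castSucc_succAbove_castSucc]
    have h2 : a.castSucc.succAbove (b.castSucc.succAbove (Fin.last k)) = Fin.last (k + 2) := by
      rw [succAbove_castSucc_last, succAbove_castSucc_last]
    have h3 : (fun i : Fin (k + 1) => (Matrix.vecCons (vbracket (v a.castSucc)
        (v (a.castSucc.succAbove b.castSucc))) (fun t => v (a.castSucc.succAbove
          (b.castSucc.succAbove t))) : Fin (k + 2) → VField E M) i.castSucc) =
        Matrix.vecCons (vbracket (v a.castSucc) (v (a.succAbove b).castSucc))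
          (fun t => v (a.succAbove (b.succAbove t)).castSucc) := by
      funext i
      refine Fin.cases ?_ (fun i => ?_) i
      · rw [Fin.castSucc_succAbove_castSucc]
        rfl
      · exact congrArg v (h1 i)
    rw [h3, iotas_cons]
    congr 2
    exact congrArg (fun i => iota (v i)) h2
  · rw [if_pos (by simp [Fin.le_last]), succAbove_castSucc_last, iotas_cons, iotas_cons,
      vbracket_swap (v a.castSucc), Fin.val_castSucc, Fin.val_last,
      show (a : ℕ) + (k + 1) = k + a + 1 by ring, pow_succ, pow_add, mul_neg_one]
    simp only [Fin.succAbove_last, Fin.castSucc_succAbove_castSucc]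
    refine LinearMap.ext fun α => ?_
    simp only [Module.End.mul_apply, LinearMap.smul_apply, map_neg, LinearMap.neg_apply]
    rw [neg_smul, smul_neg, neg_neg, smul_smul]

/-- The multi-contraction Cartan formula for forms with vanishing Lie derivatives. -/
lemma dEnd_iotas {k : ℕ} (v : Fin (k + 2) → VField E M) {α : TotalForms E M}
    (h : ∀ i, lieEnd (v i) α = 0) :
    dEnd E M (iotas (k + 2) v α) =
      (-1 : ℝ) ^ k • (iotas (k + 2) v (dEnd E M α) - bracketContraction v α) := by
  -- Cartan's formula solved for `d ι_w`: each step of the induction peels off the outermost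
  -- contraction, producing brackets with its vector field from `L_w` and the previous case from
  -- `ι_w d`.
  have hd : ∀ (w : VField E M) (β : TotalForms E M),
      dEnd E M (iota w β) = lieEnd w β - iota w (dEnd E M β) := by
    intro w β; simp [lieEnd]
  induction k with
  | zero =>
    have h1 := LinearMap.congr_fun (lieEnd_mul_iota (v 1) (v 0)) α
    simp only [Module.End.mul_apply, LinearMap.add_apply, h, map_zero, zero_add] at h1
    have e : iotas 2 v = iota (v 1) * iota (v 0) := by simp [iotas]
    have e' : bracketContraction v = iota (vbracket (v 0) (v 1)) := by
      simp [bracketContraction, iotas]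
    rw [e, e', Module.End.mul_apply, hd, h1, hd, h, vbracket_swap (v 0) (v 1)]
    simp
    abel
  | succ k ih =>
    have h1 := LinearMap.congr_fun
      (lieEnd_mul_iotas (v (Fin.last _)) (k + 1) (fun i => v i.castSucc)) α
    simp only [Module.End.mul_apply, LinearMap.add_apply, h, map_zero, zero_add] at h1
    rw [iotas_succ_last, Module.End.mul_apply, hd, h1, ih _ (fun i => h i.castSucc),
      bracketContraction_succ]
    simp only [LinearMap.add_apply, Module.End.mul_apply, LinearMap.smul_apply, map_smul, map_sub,
      smul_sub, smul_add, smul_smul, pow_succ]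
    have hs : (-1 : ℝ) ^ k * -1 * (-1) ^ k = -1 := by
      rw [mul_right_comm, ← mul_pow]
      simp
    rw [hs]
    module

end Forms

/-! ### The co-moment map of an invariant potential. -/

section Comoment

variable {E : Type*} [NormedAddCommGroup E] [NormedSpace ℝ E] [FiniteDimensional ℝ E]
  {M : Type*} [TopologicalSpace M] [ChartedSpace E M] [IsManifold 𝓘(ℝ, E) smooth M]
  {𝔤 : Type*} [LieRing 𝔤] [LieAlgebra ℝ 𝔤] {n : ℕ}

lemma neg_one_units_pow_smul {V : Type*} [AddCommGroup V] [Module ℝ V] (m : ℕ) (y : V) :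
    ((-1 : ℤˣ) ^ m) • y = ((-1 : ℝ) ^ m) • y := by
  rcases Nat.even_or_odd m with h | h <;> simp [h.neg_one_pow]

lemma dEnd_ofForm {k : ℕ} (τ : DiffForm E M k) :
    dEnd E M (ofForm τ) = ofForm (extD E M k τ) := by
  funext j
  cases j with
  | zero => exact (ofForm_ne _ _ (by omega)).symm
  | succ j =>
    change extD E M j (ofForm τ j) = _
    by_cases h : j = k
    · subst h; simp [ofForm]
    · rw [ofForm_ne _ _ h, ofForm_ne _ _ (by omega), map_zero]

/-- The sign `(-1)^k (-1)^{k(k+1)/2}`. -/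
def comomentSign (k : ℕ) : ℝ := (-1) ^ k * (-1) ^ (k * (k + 1) / 2)

/-- Consequently the coefficient `-(-1)^{m(m+1)/2}` of `l_m` is the sign of `f_{m-1}`, which lets
the morphism equation balance. -/
lemma neg_one_pow_triangle_succ (k : ℕ) :
    (-1 : ℝ) ^ ((k + 1) * (k + 1 + 1) / 2) = -comomentSign k := by
  have h : (k + 1) * (k + 1 + 1) / 2 = k * (k + 1) / 2 + (k + 1) := by
    rw [show (k + 1) * (k + 1 + 1) = k * (k + 1) + (k + 1) * 2 by ring,
      Nat.add_mul_div_right _ _ two_pos]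
  rw [h, comomentSign]
  ring

lemma comomentSign_succ (k : ℕ) :
    comomentSign (k + 1) = (-1) ^ k * comomentSign k := by
  rw [comomentSign, neg_one_pow_triangle_succ, pow_succ]
  ring

/-- The form component `± ι_{ζ(X_k)} ⋯ ι_{ζ(X_1)} η` of a homotopy co-moment map. -/
def comomentForm (ζ : InfinitesimalAction E M 𝔤) (η : DiffForm E M n) (k : ℕ) :
    𝔤 [⋀^Fin k]→ₗ[ℝ] TotalForms E M :=
  comomentSign k • (LinearMap.applyₗ (ofForm η) : Module.End ℝ (TotalForms E M) →ₗ[ℝ]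
    TotalForms E M).compAlternatingMap ((iotasAlt k).compLinearMap ζ.toLinearMap)

lemma comomentForm_apply (ζ : InfinitesimalAction E M 𝔤) (η : DiffForm E M n) (k : ℕ)
    (X : Fin k → 𝔤) : comomentForm ζ η k X =
      comomentSign k • iotas k (fun i => ζ.toLinearMap (X i)) (ofForm η) := by
  rw [← iotasAlt_apply]
  rfl

/-- Contracting an `n`-form `k` times leaves only degree `n - k`; in particular everything vanishes
for `k > n`. -/
lemma comomentForm_apply_eq_zero (ζ : InfinitesimalAction E M 𝔤) (η : DiffForm E M n) {k j : ℕ}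
    (h : j + k ≠ n) (X : Fin k → 𝔤) : comomentForm ζ η k X j = 0 := by
  rw [comomentForm_apply, Pi.smul_apply, iotas_apply_eq_zero h _ (ofForm_ne η), smul_zero]

/-- The vector field component of a homotopy co-moment map. -/
def comomentVec (ζ : InfinitesimalAction E M 𝔤) : (k : ℕ) → 𝔤 [⋀^Fin k]→ₗ[ℝ] VField E M
  | 1 => AlternatingMap.ofSubsingleton ℝ 𝔤 (VField E M) 0 ζ.toLinearMap
  | _ => 0

lemma comomentVec_one (ζ : InfinitesimalAction E M 𝔤) (X : Fin 1 → 𝔤) :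
    comomentVec ζ 1 X = ζ.toLinearMap (X 0) := rfl

lemma comomentVec_of_ne (ζ : InfinitesimalAction E M 𝔤) {k : ℕ} (hk : k ≠ 1) :
    comomentVec ζ k = 0 := by
  match k, hk with
  | 0, _ => rfl
  | k + 2, _ => rfl

variable {ω : DiffForm E M (n + 1)} {ζ : InfinitesimalAction E M 𝔤} {η : DiffForm E M n}

/-- For `k = 1` the constraint is Cartan's formula with `L_v η = 0` and `dη = ω`. For `k ≥ 2` both
of its sides vanish: there is no vector field and no form of degree `n - 1`. -/
lemma comoment_mem (hη : extD E M n η = ω) (hinv : IsInvariant ζ η) {k : ℕ} (hk : 1 ≤ k)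
    (X : Fin k → 𝔤) : (comomentVec ζ k X, comomentForm ζ η k X) ∈ Observables ω := by
  refine ⟨fun j hj => comomentForm_apply_eq_zero ζ η (by omega) X, ?_⟩
  by_cases h1 : k = 1
  · subst h1
    have h := congrFun (lieEnd_ofForm_eq_zero (ζ.toLinearMap (X 0)) η (hinv (X 0))) n
    have e : comomentForm ζ η 1 X = iota (ζ.toLinearMap (X 0)) (ofForm η) := by
      rw [comomentForm_apply]
      simp [comomentSign, iotas]
    rw [e, comomentVec_one]
    refine eq_neg_of_add_eq_zero_left ((congrArg _ ?_).trans h)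
    rw [Module.End.mul_apply, dEnd_ofForm, hη]
    change _ = contract n _ (ofForm ω (n + 1))
    simp [ofForm]
  · rw [comomentVec_of_ne ζ h1]
    simp only [AlternatingMap.zero_apply, map_zero, LinearMap.zero_apply, neg_zero]
    cases n with
    | zero => rfl
    | succ m =>
      change extD E M m (comomentForm ζ η k X m) = 0
      rw [comomentForm_apply_eq_zero ζ η (by omega), map_zero]

/-- The components of the homotopy co-moment map determined by an invariant potential. -/
def comoment (hη : extD E M n η = ω) (hinv : IsInvariant ζ η) :
    (k : ℕ) → 𝔤 [⋀^Fin k]→ₗ[ℝ] Observables ω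
  | 0 => 0
  | k + 1 => ((comomentVec ζ (k + 1)).prod (comomentForm ζ η (k + 1))).codRestrict _
      (comoment_mem hη hinv (by omega))

lemma comoment_vec (hη : extD E M n η = ω) (hinv : IsInvariant ζ η) {k : ℕ} (hk : 1 ≤ k)
    (X : Fin k → 𝔤) : (comoment hη hinv k X).1.1 = comomentVec ζ k X := by
  obtain ⟨k, rfl⟩ := Nat.exists_eq_add_of_le' hk
  rfl

lemma comoment_vec_eq_zero (hη : extD E M n η = ω) (hinv : IsInvariant ζ η) {k : ℕ} (hk : 2 ≤ k)
    (X : Fin k → 𝔤) : (comoment hη hinv k X).1.1 = 0 := by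
  rw [comoment_vec hη hinv (by omega), comomentVec_of_ne ζ (by omega)]
  rfl

lemma comoment_form (hη : extD E M n η = ω) (hinv : IsInvariant ζ η) {k : ℕ} (hk : 1 ≤ k)
    (X : Fin k → 𝔤) : (comoment hη hinv k X).1.2 = comomentForm ζ η k X := by
  obtain ⟨k, rfl⟩ := Nat.exists_eq_add_of_le' hk
  rfl

/-- Reduces each graded identity to arguments of degree zero, where Koszul signs are trivial, or to
a vanishing argument. -/
lemma exists_eq_zero_of_lieBrackets_gr {k : ℕ} {d : Fin k → ℤ} {x : Fin k → 𝔤}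
    (hx : ∀ i, x i ∈ (lieBrackets 𝔤).gr (d i)) : (∀ i, d i = 0) ∨ ∃ i, x i = 0 := by
  refine or_iff_not_imp_left.2 fun hd => ?_
  push Not at hd
  obtain ⟨i, hi⟩ := hd
  have h : x i ∈ (if d i = 0 then ⊤ else ⊥ : Submodule ℝ 𝔤) := hx i
  rw [if_neg hi] at h
  exact ⟨i, by simpa using h⟩

lemma comoment_gr (hη : extD E M n η = ω) (hinv : IsInvariant ζ η) (k : ℕ) (d : Fin k → ℤ)
    (x : Fin k → 𝔤) (hx : ∀ i, x i ∈ (lieBrackets 𝔤).gr (d i)) :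
    comoment hη hinv k x ∈ obsGr ω ((∑ i, d i) + (1 - (k : ℤ))) := by
  rcases Nat.eq_zero_or_pos k with rfl | hk
  · exact Submodule.zero_mem _
  rcases exists_eq_zero_of_lieBrackets_gr hx with hd | ⟨i, hi⟩
  · simp only [hd, Finset.sum_const_zero, zero_add]
    refine ⟨fun h => ?_, fun j hj => ?_⟩
    · rw [comoment_vec _ _ hk, comomentVec_of_ne ζ (by rintro rfl; simp at h)]
      rfl
    · rw [comoment_form _ _ hk]
      exact comomentForm_apply_eq_zero ζ η (by omega) x
  · rw [AlternatingMap.map_coord_zero _ i hi]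
    exact Submodule.zero_mem _

lemma comoment_skew (hη : extD E M n η = ω) (hinv : IsInvariant ζ η) (k : ℕ)
    (σ : Equiv.Perm (Fin k)) (d : Fin k → ℤ) (x : Fin k → 𝔤)
    (hx : ∀ i, x i ∈ (lieBrackets 𝔤).gr (d i)) :
    comoment hη hinv k (fun i => x (σ i)) =
      (Equiv.Perm.sign σ * koszulSign σ d) • comoment hη hinv k x := by
  rcases exists_eq_zero_of_lieBrackets_gr hx with hd | ⟨i, hi⟩
  · rw [koszulSign_zero σ d hd, mul_one]
    exact AlternatingMap.map_perm _ x σ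
  · rw [AlternatingMap.map_coord_zero _ i hi, smul_zero]
    exact AlternatingMap.map_coord_zero _ (σ.symm i) (by simpa using hi)

variable (hn : 1 ≤ n) (hω : extD E M (n + 1) ω = 0)

lemma observables_l_one (y : Observables ω) : (observables ω hn hω).l 1 ![y] = obsL1 ω y := rfl

/-- The formula for the higher brackets also covers arity two, because `-(-1)^3 = 1`. -/
lemma observables_l_form (k : ℕ) (y : Fin (k + 2) → Observables ω) :
    ((observables ω hn hω).l (k + 2) y).1.2 =
      (-(-1 : ℝ) ^ ((k + 2) * (k + 2 + 1) / 2)) • iotas (k + 2) (fun i => (y i).1.1) (ofForm ω) := by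
  cases k with
  | zero =>
    have e : ((observables ω hn hω).l 2 y).1.2 =
      iota (y 1).1.1 (iota (y 0).1.1 (ofForm ω)) := rfl
    rw [e]
    norm_num
    simp [iotas]
  | succ k => rfl

lemma observables_l_eq_zero {k : ℕ} (hk : 2 ≤ k) {y : Fin k → Observables ω}
    (i : Fin k) (hi : (y i).1.1 = 0) : (observables ω hn hω).l k y = 0 := by
  obtain ⟨k, rfl⟩ := Nat.exists_eq_add_of_le' hk
  refine Subtype.ext (Prod.ext ?_ ?_)
  · cases k with
    | zero =>
      change vbracket (y 0).1.1 (y 1).1.1 = 0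
      have h : ∀ v : VField E M, vbracket 0 v = 0 := fun v => by
        simpa using vbracket_smul_left 0 0 v
      fin_cases i
      · exact (congrArg (fun v => vbracket v _) hi).trans (h _)
      · rw [vbracket_swap, neg_eq_zero]
        exact (congrArg (fun v => vbracket v _) hi).trans (h _)
    | succ k => rfl
  · rw [observables_l_form, ← iotasAlt_apply, AlternatingMap.map_coord_zero _ i hi]
    simp

/-- A form of degree `n - 1` is annihilated because `obsL1` discards degrees `≥ n`, in accordance
with `l_1 = 0` on `L_0`. -/
lemma obsL1_eq_zero_of_form {y : Observables ω} (h : ∀ j, j + 1 ≠ n → y.1.2 j = 0) :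
    obsL1 ω y = 0 := by
  refine Subtype.ext (Prod.ext rfl (funext fun j => ?_))
  change (if j < n then dTot E M y.1.2 j else 0) = 0
  split_ifs with hj
  swap; · rfl
  cases j with
  | zero => rfl
  | succ j =>
    change extD E M j _ = 0
    rw [h j (by omega), map_zero]

/-- Without a component of degree `n - 1` or more, the truncation in `obsL1` discards nothing. This
applies to `f_k` for `k ≥ 2`. -/
lemma obsL1_form {y : Observables ω} (h : ∀ j, n ≤ j + 1 → y.1.2 j = 0) :
    (obsL1 ω y).1.2 = dEnd E M y.1.2 := by
  funext j
  change (if j < n then dTot E M y.1.2 j else 0) = dTot E M y.1.2 j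
  split_ifs with hj
  · rfl
  · cases j with
    | zero => rfl
    | succ j =>
      change 0 = extD E M j _
      rw [h j (by omega), map_zero]

lemma comoment_equation (hη : extD E M n η = ω) (hinv : IsInvariant ζ η) (k : ℕ)
    (x : Fin (k + 2) → 𝔤) :
    (∑ a : Fin (k + 2), ∑ b : Fin (k + 1), if a ≤ b.castSucc then
      ((-1 : ℤˣ) ^ ((a : ℕ) + b)) • comoment hη hinv (k + 1) (Matrix.vecCons
        ⁅x a, x (a.succAbove b)⁆ (fun t => x (a.succAbove (b.succAbove t)))) else 0) =
    (observables ω hn hω).l 1 ![comoment hη hinv (k + 2) x] +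
      (observables ω hn hω).l (k + 2) (fun i => comoment hη hinv 1 ![x i]) := by
  refine Subtype.ext (Prod.ext ?_ ?_)
  · cases k with
    -- For two arguments the vector components express that `ζ` preserves brackets.
    | zero =>
      have h : (comoment hη hinv 1 ![⁅x 0, x 1⁆]).1.1 =
          vbracket (comoment hη hinv 1 ![x 0]).1.1 (comoment hη hinv 1 ![x 1]).1.1 := by
        rw [comoment_vec _ _ le_rfl, comoment_vec _ _ le_rfl, comoment_vec _ _ le_rfl]
        exact ζ.map_lie _ _
      have e : ((observables ω hn hω).l 1 ![comoment hη hinv 2 x] +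
        (observables ω hn hω).l 2 (fun i => comoment hη hinv 1 ![x i])).1.1 =
        0 + vbracket (comoment hη hinv 1 ![x 0]).1.1 (comoment hη hinv 1 ![x 1]).1.1 := rfl
      refine Eq.trans ?_ (e.trans ((zero_add _).trans h.symm)).symm
      have hsum : ∀ G : Fin 2 → Fin 1 → Observables ω,
          ∑ a, ∑ b, (if a ≤ Fin.castSucc b then G a b else 0) = G 0 0 := by
        intro G; simp
      refine congrArg (fun y : Observables ω => y.1.1) ((hsum _).trans ?_)
      refine (one_smul ℤˣ _).trans (congrArg (comoment hη hinv 1) ?_)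
      exact congrArg (Matrix.vecCons _) (Subsingleton.elim _ _)
    -- For three or more arguments neither `l_1`, nor a bracket of arity at least three, nor an
    -- `f_j` with `j ≥ 2` has a vector component.
    | succ k =>
      have e : ((observables ω hn hω).l 1 ![comoment hη hinv (k + 3) x] +
        (observables ω hn hω).l (k + 3) (fun i => comoment hη hinv 1 ![x i])).1.1 = 0 + 0 := rfl
      refine Eq.trans ?_ (e.trans (add_zero 0)).symm
      change obsVec ω _ = 0
      rw [map_sum]
      refine Finset.sum_eq_zero fun a _ => ?_
      rw [map_sum]
      refine Finset.sum_eq_zero fun b _ => ?_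
      split_ifs
      · rw [neg_one_units_pow_smul, map_smul]
        refine (congrArg _ ?_).trans (smul_zero _)
        exact comoment_vec_eq_zero hη hinv (k := k + 2) (by omega)
          (Matrix.vecCons ⁅x a, x (a.succAbove b)⁆ (fun t => x (a.succAbove (b.succAbove t))))
      · exact map_zero _
  · have hl : ∀ i, lieEnd (ζ.toLinearMap (x i)) (ofForm η) = 0 := fun i =>
      lieEnd_ofForm_eq_zero _ η (hinv (x i))
    have hS : (∑ a : Fin (k + 2), ∑ b : Fin (k + 1), if a ≤ b.castSucc then
        ((-1 : ℤˣ) ^ ((a : ℕ) + b)) • comoment hη hinv (k + 1) (Matrix.vecCons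
        ⁅x a, x (a.succAbove b)⁆ (fun t => x (a.succAbove (b.succAbove t)))) else 0).1.2 =
        comomentSign (k + 1) •
          bracketContraction (fun i => ζ.toLinearMap (x i)) (ofForm η) := by
      set φ : Observables ω →ₗ[ℝ] TotalForms E M :=
        (LinearMap.snd ℝ _ _).comp (Observables ω).subtype
      change φ _ = _
      simp only [bracketContraction, map_sum, LinearMap.sum_apply, Finset.smul_sum]
      refine Finset.sum_congr rfl fun a _ => Finset.sum_congr rfl fun b _ => ?_
      split_ifs
      · rw [neg_one_units_pow_smul, map_smul, LinearMap.smul_apply, smul_comm]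
        congr 1
        refine (comoment_form hη hinv (k := k + 1) (by omega) _).trans ?_
        rw [comomentForm_apply, iotas_cons, ← ζ.map_lie]
        rfl
      · simp
    have hR : ((observables ω hn hω).l 1 ![comoment hη hinv (k + 2) x] +
        (observables ω hn hω).l (k + 2) (fun i => comoment hη hinv 1 ![x i])).1.2 =
        comomentSign (k + 2) • dEnd E M (iotas (k + 2) (fun i => ζ.toLinearMap (x i)) (ofForm η)) +
        (-(-1 : ℝ) ^ ((k + 2) * (k + 2 + 1) / 2)) •
          iotas (k + 2) (fun i => ζ.toLinearMap (x i)) (ofForm ω) := by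
      refine congrArg₂ (· + ·) ?_ (observables_l_form hn hω k _)
      rw [observables_l_one, obsL1_form, comoment_form _ _ (by omega), comomentForm_apply, map_smul]
      intro j hj
      rw [comoment_form _ _ (by omega)]
      exact comomentForm_apply_eq_zero ζ η (by omega) x
    -- After inserting the multi-contraction formula, the contraction of `ω` coming from `d` cancels
    -- the one from the higher bracket, and the brackets that remain are the left hand side.
    rw [hS, hR, dEnd_iotas _ hl, dEnd_ofForm, hη, neg_one_pow_triangle_succ (k + 1),
      comomentSign_succ (k + 1), pow_succ, smul_smul]
    have hs : (-1 : ℝ) ^ k * -1 * comomentSign (k + 1) * (-1) ^ k = -comomentSign (k + 1) := by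
      rw [mul_right_comm, mul_right_comm _ (-1 : ℝ), ← mul_pow]
      simp
    rw [hs]
    module

/-- The homotopy co-moment map determined by an invariant potential. -/
def potentialComomentMap (hη : extD E M n η = ω) (hinv : IsInvariant ζ η) :
    HomotopyComomentMap ω hn hω ζ where
  f k := (comoment hη hinv k).toMultilinearMap
  f_zero := rfl
  f_mem := comoment_gr hη hinv
  f_skew := comoment_skew hη hinv
  map_brackets := by
    intro m hm d x hx
    rcases exists_eq_zero_of_lieBrackets_gr hx with hd | ⟨i, hi⟩
    swap
    · exact morphism_equation_of_eq_zero (lieBrackets 𝔤) (observables ω hn hω)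
        (fun k => (comoment hη hinv k).toMultilinearMap) d x i hi
    match m, hm with
    -- The left side vanishes since `𝔤` has no unary bracket; the right side is `l_1` of an element
    -- of `L_0`.
    | 1, _ =>
      trans (0 : Observables ω)
      · refine Finset.sum_eq_zero fun i _ => Finset.sum_eq_zero fun σ _ => ?_
        rw [MultilinearMap.map_coord_zero _ ⟨0, by omega⟩, smul_zero]
        rw [if_pos rfl, lieBrackets_l_of_ne (by omega)]
        rfl
      · symm
        refine Finset.sum_eq_zero fun c _ => Finset.sum_eq_zero fun σ _ => ?_
        have hc : c.length = 1 :=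
          le_antisymm c.length_le (c.length_pos_of_pos one_pos)
        refine (congrArg _ ?_).trans (smul_zero _)
        rw [multilinear_family_congr (observables ω hn hω).l hc
          (y := ![(comoment hη hinv 1).toMultilinearMap x])]
        · refine (observables_l_one hn hω _).trans (obsL1_eq_zero_of_form fun j hj => ?_)
          exact (congrFun (comoment_form hη hinv le_rfl x) j).trans
            (comomentForm_apply_eq_zero ζ η hj x)
        · intro t
          have hb : c.blocksFun t = 1 :=
            le_antisymm (c.blocksFun_le t) (c.one_le_blocksFun t)
          have e : ∀ s : Fin 1, ![(comoment hη hinv 1).toMultilinearMap x] s =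
            (comoment hη hinv 1).toMultilinearMap x := fun s => by
              rw [Subsingleton.elim s 0]; rfl
          rw [e]
          exact multilinear_family_congr (fun k => (comoment hη hinv k).toMultilinearMap) hb
            fun s => congrArg x (Subsingleton.elim _ _)
    | k + 2, _ =>
      refine (lieBrackets_source_sum (fun k => (comoment hη hinv k).toMultilinearMap)
        x d hd).trans ?_
      refine Eq.trans ?_ (target_sum_eq (observables ω hn hω)
        (fun k => (comoment hη hinv k).toMultilinearMap) ?_ (by omega) d x hd).symm
      · exact comoment_equation hn hω hη hinv k x
      · rintro j y hj ⟨i, m, hm, X, hX⟩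
        refine observables_l_eq_zero hn hω hj i ?_
        rw [hX]
        exact comoment_vec_eq_zero hη hinv hm X
  lift X := comoment_vec hη hinv le_rfl ![X]

end Comoment

end Multisymplectic

end

theorem mainTheorem7
    {E : Type*} [NormedAddCommGroup E] [NormedSpace ℝ E] [FiniteDimensional ℝ E]
    {M : Type*} [TopologicalSpace M] [ChartedSpace E M]
    [IsManifold 𝓘(ℝ, E) Multisymplectic.smooth M]
    {𝔤 : Type*} [LieRing 𝔤] [LieAlgebra ℝ 𝔤] [FiniteDimensional ℝ 𝔤]
    (n : ℕ) (hn : 1 ≤ n)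
    (ω : Multisymplectic.DiffForm E M (n + 1))
    (hω : Multisymplectic.extD E M (n + 1) ω = 0)
    (ζ : Multisymplectic.InfinitesimalAction E M 𝔤)
    (_hζ : Multisymplectic.IsInvariant ζ ω)
    (η : Multisymplectic.DiffForm E M n)
    (_hη : Multisymplectic.extD E M n η = ω)
    (_hinv : Multisymplectic.IsInvariant ζ η) :
    Multisymplectic.IsStronglyHamiltonian ω hn hω ζ ∧
      ∃ F : Multisymplectic.HomotopyComomentMap ω hn hω ζ,
        (∀ X : 𝔤, (F.f 1 ![X] : Multisymplectic.VField E M × Multisymplectic.TotalForms E M) =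
          (ζ.toLinearMap X,
            Multisymplectic.iota (ζ.toLinearMap X) (Multisymplectic.ofForm η))) ∧
        ∀ k : ℕ, 2 ≤ k → ∀ X : Fin k → 𝔤,
          (F.f k X : Multisymplectic.VField E M × Multisymplectic.TotalForms E M) =
            (0, ((-1 : ℝ) ^ k * (-1 : ℝ) ^ (k * (k + 1) / 2)) •
              Multisymplectic.iotas k (fun i => ζ.toLinearMap (X i))
                (Multisymplectic.ofForm η)) := by
  have h1 : ∀ X : 𝔤, (((Multisymplectic.potentialComomentMap hn hω _hη _hinv).f 1 ![X] :
      Multisymplectic.Observables ω) : Multisymplectic.VField E M × Multisymplectic.TotalForms E M) =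
      (ζ.toLinearMap X, Multisymplectic.iota (ζ.toLinearMap X) (Multisymplectic.ofForm η)) := by
    intro X
    refine Prod.ext (Multisymplectic.comoment_vec _hη _hinv le_rfl ![X]) ?_
    refine (Multisymplectic.comoment_form _hη _hinv le_rfl ![X]).trans ?_
    rw [Multisymplectic.comomentForm_apply]
    -- The general sign equals `1` at `k = 1`, so `f_1` fits the same formula as the higher
    -- components.
    simp [Multisymplectic.comomentSign, Multisymplectic.iotas]
  refine ⟨⟨Multisymplectic.potentialComomentMap hn hω _hη _hinv⟩,
    Multisymplectic.potentialComomentMap hn hω _hη _hinv, h1, fun k hk X => Prod.ext ?_ ?_⟩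
  · exact Multisymplectic.comoment_vec_eq_zero _hη _hinv hk X
  · exact (Multisymplectic.comoment_form _hη _hinv (by omega) X).trans
      (Multisymplectic.comomentForm_apply ζ η k X)
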